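/- Let $\mathbb{K}=\mathbb{R}$ or $\mathbb{C}$, and let $A=(a_{j,k})_{j,k\ge 1}$ be a matrix of real numbers with $a_{j,k}>0$ and $a_{j,k}\le a_{j+1,k}$ for all $j,k\ge 1$. For $1\le p<\infty$ let $$\lambda^p(A)=\Big\{x\in\mathbb{K}^{\mathbb{N}} : p_j(x)=\Big(\sum_{k\ge 1}|x_k a_{j,k}|^p\Big)^{1/p}<\infty \text{ for all } j\ge 1\Big\},$$ $$c_0(A)=\Big\{x\in\mathbb{K}^{\mathbb{N}} : \lim_{k\to\infty}|x_k|a_{j,k}=0 \text{ for all } j\ge 1\Big\},\qquad p_j(x)=\max_k |x_k|a_{j,k},$$ each with the topology generated by its norms $p_j$, $j\ge 1$. Let $X=\lambda^p(A)$ with $1\le p<\infty$, or $X=c_0(A)$. Let $(w_n)_{n\ge 1}$ be a sequence of non-zero scalars, and suppose that the weighted shift $(B_wx)_k=w_{k+1}x_{k+1}$ (that is, $B_we_n=w_ne_{n-1}$ with $e_0=0$) defines a continuous linear operator $B_w:X\to X$ that is hypercyclic, i.e. there is $x\in X$ such that $\{B_w^nx:n\ge 1\}$ is dense in $X$; such an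 $x$ is called a hypercyclic vector. Suppose that $J\ge 1$ is such that for all $m\ge 1$ and all $j\ge 1$ there exists $m_j\ge 1$ with $$\sup_{n\ge 0}\,\limsup_{k\to\infty}\,\frac{a_{j,k}\,a_{m,n+k}}{a_{J,k}\,a_{m_j,n+k}}<\infty.$$ Then the following are equivalent: 1. $B_w$ has a hypercyclic subspace, i.e. there is an infinite-dimensional closed subspace of $X$ in which every non-zero vector is hypercyclic for $B_w$; 2. there exists $m\ge 1$ such that $$\sup_{n\ge 1}\,\inf_{k\ge 1}\,\frac{\prod_{\nu=1}^{n}|w_{\nu+k}|\;a_{J,k}}{a_{m,n+k}}\le 1;$$ 3. there exists $m\ge 1$ such that $$\sup_{n\ge 1}\,\inf_{k\ge 1}\,\frac{\prod_{\nu=1}^{n}|w_{\nu+k}|\;a_{J,k}}{a_{m,n+k}}<\infty.$$ -/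

import Mathlib

open Filter Topology
open scoped ENNReal

noncomputable section

section Hypercyclicity

variable {𝕜 X : Type*} [NormedField 𝕜] [AddCommGroup X] [Module 𝕜 X] [TopologicalSpace X]

/-- `x` is a hypercyclic vector of the operator `T` if `{Tⁿ x : n ≥ 1}` is dense. -/
def IsHypercyclicVector (T : X →L[𝕜] X) (x : X) : Prop :=
  Dense {y : X | ∃ n : ℕ, 1 ≤ n ∧ y = (⇑T)^[n] x}

/-- An operator is hypercyclic if it has a hypercyclic vector. -/
def IsHypercyclicOperator (T : X →L[𝕜] X) : Prop :=
  ∃ x : X, IsHypercyclicVector T x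

/-- `T` has a hypercyclic subspace: an infinite-dimensional closed subspace in which every
non-zero vector is hypercyclic. -/
def HasHypercyclicSubspace (T : X →L[𝕜] X) : Prop :=
  ∃ M : Submodule 𝕜 X, IsClosed (M : Set X) ∧ ¬ FiniteDimensional 𝕜 M ∧
    ∀ x ∈ M, x ≠ 0 → IsHypercyclicVector T x

end Hypercyclicity

/-- A Köthe matrix `(a_{j,k})`: positive entries, increasing in `j`. All indices (of matrices and
of sequences) run over `ℕ = {0, 1, 2, …}`: index `i` here is index `i + 1` in a numbering
that starts at `1`. -/
structure KotheMatrix where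
  entry : ℕ → ℕ → ℝ
  entry_pos : ∀ j k, 0 < entry j k
  entry_le_succ : ∀ j k, entry j k ≤ entry (j + 1) k

instance : CoeFun KotheMatrix (fun _ => ℕ → ℕ → ℝ) := ⟨KotheMatrix.entry⟩

section Spaces

variable (𝕜 : Type*) [RCLike 𝕜] (p : ℝ) [Fact (1 ≤ p)] (A : KotheMatrix)

/-- The vector space `λ^p(A)` of the sequences `x` with `∑_k |x_k a_{j,k}|^p < ∞` for all `j`. -/
def kotheLpSubmodule : Submodule 𝕜 (ℕ → 𝕜) where
  carrier := {x | ∀ j, Summable fun k => (‖x k‖ * A j k) ^ p}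
  add_mem' := by
    intro x y hx hy j
    have hp : 1 ≤ p := Fact.out
    have h := Real.summable_Lp_add_of_nonneg hp
      (fun k => mul_nonneg (norm_nonneg (x k)) (A.entry_pos j k).le)
      (fun k => mul_nonneg (norm_nonneg (y k)) (A.entry_pos j k).le) (hx j) (hy j)
    refine Summable.of_nonneg_of_le
      (fun k => Real.rpow_nonneg (mul_nonneg (norm_nonneg _) (A.entry_pos j k).le) p)
      (fun k => ?_) h
    refine Real.rpow_le_rpow (mul_nonneg (norm_nonneg _) (A.entry_pos j k).le) ?_ (by linarith)
    rw [← add_mul]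
    exact mul_le_mul_of_nonneg_right (norm_add_le _ _) (A.entry_pos j k).le
  zero_mem' := by
    intro j
    have hp : 1 ≤ p := Fact.out
    simp [Real.zero_rpow (by linarith : p ≠ 0)]
  smul_mem' := by
    intro c x hx j
    refine ((hx j).mul_left (‖c‖ ^ p)).congr fun k => ?_
    rw [Pi.smul_apply, norm_smul, mul_assoc,
      Real.mul_rpow (norm_nonneg c) (mul_nonneg (norm_nonneg _) (A.entry_pos j k).le)]

/-- The space `λ^p(A)` as a type of its own; its topology is the one given by the norms
`kotheLpNorm`, not the one of pointwise convergence. -/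
def KotheLp : Type _ := kotheLpSubmodule 𝕜 p A

instance : AddCommGroup (KotheLp 𝕜 p A) := inferInstanceAs (AddCommGroup (kotheLpSubmodule 𝕜 p A))

instance : Module 𝕜 (KotheLp 𝕜 p A) := inferInstanceAs (Module 𝕜 (kotheLpSubmodule 𝕜 p A))

instance : CoeFun (KotheLp 𝕜 p A) (fun _ => ℕ → 𝕜) := ⟨Subtype.val⟩

/-- The norm `p_j(x) = (∑_k |x_k a_{j,k}|^p)^{1/p}` on `λ^p(A)`. -/
def kotheLpNorm (j : ℕ) : Seminorm 𝕜 (KotheLp 𝕜 p A) :=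
  Seminorm.of (fun x => (∑' k, (‖x k‖ * A j k) ^ p) ^ (1 / p))
    (by
      intro x y
      have hp : 1 ≤ p := Fact.out
      have hx0 : ∀ k, 0 ≤ ‖x k‖ * A j k :=
        fun k => mul_nonneg (norm_nonneg (x k)) (A.entry_pos j k).le
      have hy0 : ∀ k, 0 ≤ ‖y k‖ * A j k :=
        fun k => mul_nonneg (norm_nonneg (y k)) (A.entry_pos j k).le
      refine le_trans ?_ (Real.Lp_add_le_tsum_of_nonneg hp hx0 hy0 (x.2 j) (y.2 j)).2
      refine Real.rpow_le_rpow (tsum_nonneg fun k => Real.rpow_nonneg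
        (mul_nonneg (norm_nonneg _) (A.entry_pos j k).le) p) ?_ (by positivity)
      refine Summable.tsum_le_tsum (fun k => ?_) ((x + y).2 j)
        (Real.summable_Lp_add_of_nonneg hp hx0 hy0 (x.2 j) (y.2 j))
      refine Real.rpow_le_rpow (mul_nonneg (norm_nonneg _) (A.entry_pos j k).le) ?_ (by linarith)
      rw [← add_mul]
      exact mul_le_mul_of_nonneg_right (norm_add_le _ _) (A.entry_pos j k).le)
    (by
      intro c x
      have hp : 1 ≤ p := Fact.out
      have h : ∀ k, (‖(c • x) k‖ * A j k) ^ p = ‖c‖ ^ p * (‖x k‖ * A j k) ^ p := by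
        intro k
        have h1 : (c • x) k = c • x k := rfl
        rw [h1, norm_smul, mul_assoc,
          Real.mul_rpow (norm_nonneg c) (mul_nonneg (norm_nonneg _) (A.entry_pos j k).le)]
      simp only [h]
      rw [tsum_mul_left, Real.mul_rpow (Real.rpow_nonneg (norm_nonneg c) p)
        (tsum_nonneg fun k => Real.rpow_nonneg
          (mul_nonneg (norm_nonneg _) (A.entry_pos j k).le) p),
        ← Real.rpow_mul (norm_nonneg c), mul_one_div_cancel (by linarith), Real.rpow_one])

/-- The topology of `λ^p(A)` is generated by the norms `p_j`. -/
instance : TopologicalSpace (KotheLp 𝕜 p A) :=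
  (SeminormFamily.moduleFilterBasis (kotheLpNorm 𝕜 p A)).topology

/-- The vector space `c_0(A)` of the sequences `x` with `|x_k| a_{j,k} → 0` for all `j`. -/
def kotheC0Submodule : Submodule 𝕜 (ℕ → 𝕜) where
  carrier := {x | ∀ j, Tendsto (fun k => ‖x k‖ * A j k) atTop (𝓝 0)}
  add_mem' := by
    intro x y hx hy j
    have h := (hx j).add (hy j)
    rw [add_zero] at h
    refine squeeze_zero (fun k => mul_nonneg (norm_nonneg _) (A.entry_pos j k).le)
      (fun k => ?_) h
    rw [← add_mul]
    exact mul_le_mul_of_nonneg_right (norm_add_le _ _) (A.entry_pos j k).le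
  zero_mem' := by
    intro j
    simp
  smul_mem' := by
    intro c x hx j
    have h := (hx j).const_mul ‖c‖
    rw [mul_zero] at h
    refine h.congr fun k => ?_
    rw [Pi.smul_apply, norm_smul, mul_assoc]

/-- The space `c_0(A)` as a type of its own; its topology is the one given by the norms
`kotheC0Norm`. -/
def KotheC0 : Type _ := kotheC0Submodule 𝕜 A

instance : AddCommGroup (KotheC0 𝕜 A) := inferInstanceAs (AddCommGroup (kotheC0Submodule 𝕜 A))

instance : Module 𝕜 (KotheC0 𝕜 A) := inferInstanceAs (Module 𝕜 (kotheC0Submodule 𝕜 A))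

instance : CoeFun (KotheC0 𝕜 A) (fun _ => ℕ → 𝕜) := ⟨Subtype.val⟩

/-- The norm `p_j(x) = max_k |x_k| a_{j,k}` on `c_0(A)`. -/
def kotheC0Norm (j : ℕ) : Seminorm 𝕜 (KotheC0 𝕜 A) :=
  Seminorm.of (fun x => ⨆ k, ‖x k‖ * A j k)
    (by
      intro x y
      refine ciSup_le fun k => ?_
      refine le_trans ?_ (add_le_add (le_ciSup (x.2 j).bddAbove_range k)
        (le_ciSup (y.2 j).bddAbove_range k))
      rw [← add_mul]
      exact mul_le_mul_of_nonneg_right (norm_add_le _ _) (A.entry_pos j k).le)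
    (by
      intro c x
      have h : ∀ k, ‖(c • x) k‖ * A j k = ‖c‖ * (‖x k‖ * A j k) := by
        intro k
        have h1 : (c • x) k = c • x k := rfl
        rw [h1, norm_smul, mul_assoc]
      simp only [h]
      rw [Real.mul_iSup_of_nonneg (norm_nonneg c)])

/-- The topology of `c_0(A)` is generated by the norms `p_j`. -/
instance : TopologicalSpace (KotheC0 𝕜 A) :=
  (SeminormFamily.moduleFilterBasis (kotheC0Norm 𝕜 A)).topology

end Spaces

/-- The condition
`∀ m, ∀ j, ∃ m_j, sup_{n ≥ 0} limsup_k (a_{j,k} a_{m,n+k}) / (a_{J,k} a_{m_j,n+k}) < ∞`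
on a Köthe matrix. -/
def KotheMatrix.CondB (A : KotheMatrix) (J : ℕ) : Prop :=
  ∀ m j : ℕ, ∃ mj : ℕ,
    (⨆ n : ℕ, limsup (fun k : ℕ =>
      ENNReal.ofReal ((A j k * A m (n + k)) / (A J k * A mj (n + k)))) atTop) < ∞

/-- `sup_{n ≥ 1} inf_k (∏_{ν=1}^n |w_{ν+k}|) a_{J,k} / a_{m,n+k}`, as an extended
non-negative real. -/
def shiftSup {𝕜 : Type*} [NormedField 𝕜] (A : KotheMatrix) (w : ℕ → 𝕜) (J m : ℕ) : ℝ≥0∞ :=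
  ⨆ (n : ℕ) (_ : 1 ≤ n), ⨅ k : ℕ,
    ENNReal.ofReal (((∏ ν ∈ Finset.Icc 1 n, ‖w (ν + k)‖) * A J k) / A m (n + k))

end

open Filter Topology
open scoped ENNReal

noncomputable section

/-! Write W(n,k) = |w_{k+1} ⋯ w_{k+n}|, so that W(m+n,k) = W(m,k) W(n,m+k). Everything turns on
`ShiftGrowth`: for one fixed q and every m, the ratio W(n,k) a_{q,k} / a_{m,n+k} tends to infinity
with n, uniformly in k ≥ K, where K may depend on m.

If growth holds, there is no hypercyclic subspace (`not_hasHypercyclicSubspace`). In an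
infinite-dimensional closed M a gliding hump gives y = ∑ x_j in M, where x_j has p_j-norm 2^{-j} and
vanishes on a long initial segment. The block x_j is expanded so much by the iterates of the j-th
time window that p_q(B^n y) ≥ 1 for all large n.

If growth fails, `shiftGrowth_of_not_boundedRuns` provides arbitrarily far coordinates d along which
arbitrarily many iterates stay bounded. These become the free coordinates of a closed subspace.
Every other coordinate is a small multiple of a free one, chosen with the help of hypercyclicity
(`inverseSmall`) so that some iterate turns a non-zero free coordinate into any prescribed finite
target (`hasHypercyclicSubspace`).

Conditions 2 and 3 are both equivalent to `ShiftLiminfLeOne`. If that fails, one n has a gain c > 1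
at all far coordinates; the product rule compounds this gain beyond every bound and yields growth,
which is why the bounds 1 and ∞ amount to the same. Conversely, `CondB` exchanges the norm q for J
at a cost independent of n, so `ShiftLiminfLeOne` excludes growth. The spaces λ^p(A) and c_0(A) are
treated together through `SolidNorm`. -/

/-- The product `w_{k+1} ⋯ w_{k+n}`, by which the `n`-th iterate of the weighted shift carries
the coordinate `n + k` to the coordinate `k`. -/
def shiftProd {𝕜 : Type*} [NormedField 𝕜] (w : ℕ → 𝕜) (n k : ℕ) : 𝕜 :=
  ∏ ν ∈ Finset.Icc 1 n, w (ν + k)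

section ShiftProd

variable {𝕜 : Type*} [NormedField 𝕜] {w : ℕ → 𝕜}

@[simp] lemma shiftProd_zero (k : ℕ) : shiftProd w 0 k = 1 := by simp [shiftProd]

lemma shiftProd_succ (n k : ℕ) : shiftProd w (n + 1) k = shiftProd w n k * w (n + 1 + k) := by
  simp [shiftProd, Finset.prod_Icc_succ_top]

lemma shiftProd_add (m n k : ℕ) :
    shiftProd w (m + n) k = shiftProd w m k * shiftProd w n (m + k) := by
  induction n with
  | zero => simp
  | succ n ih =>
    rw [← add_assoc, shiftProd_succ, shiftProd_succ, ih, mul_assoc]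
    congr 3
    omega

lemma shiftProd_ne_zero (hw : ∀ n, w n ≠ 0) (n k : ℕ) : shiftProd w n k ≠ 0 :=
  Finset.prod_ne_zero_iff.2 fun _ _ => hw _

lemma norm_shiftProd_pos (hw : ∀ n, w n ≠ 0) (n k : ℕ) : 0 < ‖shiftProd w n k‖ :=
  norm_pos_iff.2 (shiftProd_ne_zero hw n k)

lemma norm_shiftProd_add (m n k : ℕ) :
    ‖shiftProd w (m + n) k‖ = ‖shiftProd w m k‖ * ‖shiftProd w n (m + k)‖ := by
  rw [shiftProd_add, norm_mul]

lemma norm_shiftProd (n k : ℕ) :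
    ‖shiftProd w n k‖ = ∏ ν ∈ Finset.Icc 1 n, ‖w (ν + k)‖ := by
  simp [shiftProd]

end ShiftProd

lemma KotheMatrix.entry_mono (A : KotheMatrix) {i j : ℕ} (h : i ≤ j) (k : ℕ) : A i k ≤ A j k :=
  monotone_nat_of_le_succ (fun j => A.entry_le_succ j k) h

/-! ### Growth and boundedness of the weight products -/

section Conditions

variable {𝕜 : Type*} [NormedField 𝕜] (A : KotheMatrix) (w : ℕ → 𝕜)

/-- Continuity of the weighted shift, in terms of matrix entries. -/
def ShiftBounded : Prop :=
  ∀ j, ∃ q D, 0 < D ∧ ∀ k, ‖w (k + 1)‖ * A j k ≤ D * A q (k + 1)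

/-- The iterates of the weighted shift grow uniformly along the far coordinates, measured by
one fixed norm of the image against every norm of the argument. -/
def ShiftGrowth : Prop :=
  ∃ q, ∀ m, ∃ K, ∀ R : ℝ, ∃ n₀, ∀ n, n₀ ≤ n → ∀ k, K ≤ k →
    R * A m (n + k) ≤ ‖shiftProd w n k‖ * A q k

/-- For every `n`, infinitely many entries of the `n`-th iterate are almost at most `1`. -/
def ShiftLiminfLeOne (J : ℕ) : Prop :=
  ∃ m, ∀ n, 1 ≤ n → ∀ c : ℝ, 1 < c → ∀ K, ∃ k, K ≤ k ∧
    ‖shiftProd w n k‖ * A J k < c * A m (n + k)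

/-- There are arbitrarily large coordinates along which arbitrarily many iterates are bounded
by one constant. -/
def ShiftBoundedRuns (J : ℕ) : Prop :=
  ∃ m, ∃ C : ℝ, ∀ N K, ∃ d, K ≤ d ∧ ∀ n k, n ≤ N → n + k = d →
    ‖shiftProd w n k‖ * A J k ≤ C * A m d

/-- The analogue for weighted shifts of the hypercyclicity criterion. -/
def ShiftInverseSmall : Prop :=
  ∀ j K b, ∀ ε : ℝ, 0 < ε → ∃ n, b ≤ n ∧ ∀ k, k < K → A j (n + k) < ε * ‖shiftProd w n k‖

variable {A w}

lemma ShiftBounded.iterate (h : ShiftBounded A w) (i j : ℕ) :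
    ∃ q D, 0 < D ∧ ∀ k, ‖shiftProd w i k‖ * A j k ≤ D * A q (i + k) := by
  induction i with
  | zero => exact ⟨j, 1, one_pos, fun k => by simp⟩
  | succ i ih =>
    obtain ⟨q, D, hD, hq⟩ := ih
    obtain ⟨q', D', hD', hq'⟩ := h q
    refine ⟨q', D * D', by positivity, fun k => ?_⟩
    have h1 : shiftProd w (i + 1) k = shiftProd w i k * w (i + k + 1) := by
      rw [shiftProd_succ]; congr 2; omega
    calc ‖shiftProd w (i + 1) k‖ * A j k
        = ‖w (i + k + 1)‖ * (‖shiftProd w i k‖ * A j k) := by rw [h1, norm_mul]; ring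
      _ ≤ ‖w (i + k + 1)‖ * (D * A q (i + k)) := 
          mul_le_mul_of_nonneg_left (hq k) (norm_nonneg _)
      _ = D * (‖w (i + k + 1)‖ * A q (i + k)) := by ring
      _ ≤ D * (D' * A q' (i + k + 1)) := mul_le_mul_of_nonneg_left (hq' _) hD.le
      _ = D * D' * A q' (i + 1 + k) := by rw [add_right_comm i 1 k]; ring

lemma ShiftBounded.iterate_le (h : ShiftBounded A w) (b j : ℕ) :
    ∃ q D, 0 < D ∧ ∀ i, i ≤ b → ∀ k, ‖shiftProd w i k‖ * A j k ≤ D * A q (i + k) := by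
  choose q D hD hq using fun i => h.iterate i j
  refine ⟨(Finset.range (b + 1)).sup q, ∑ i ∈ Finset.range (b + 1), D i,
    Finset.sum_pos (fun i _ => hD i) (by simp), fun i hi k => (hq i k).trans ?_⟩
  have hi' : i ∈ Finset.range (b + 1) := by simp; omega
  exact mul_le_mul (Finset.single_le_sum (fun i _ => (hD i).le) hi')
    (A.entry_mono (Finset.le_sup hi') _) (A.entry_pos _ _).le
    (Finset.sum_nonneg fun i _ => (hD i).le)

/-- Walking backwards from `d`, each hop has length at most `N` and gains a factor 2. Stopping as
soon as the total length `t` reaches `n` overshoots by at most `N`, and `t ≤ l * N` forces many hops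
when `n` is large. -/
lemma exists_pow_chain {J N K : ℕ}
    (hstep : ∀ d, K ≤ d → ∃ n k, 1 ≤ n ∧ n ≤ N ∧ n + k = d ∧
      2 * A J d ≤ ‖shiftProd w n k‖ * A J k) (n d : ℕ) (hd : K + n ≤ d) :
    ∃ t k l, t + k = d ∧ n ≤ t ∧ t ≤ n + N ∧ t ≤ l * N ∧
      2 ^ l * A J d ≤ ‖shiftProd w t k‖ * A J k := by
  induction n with
  | zero => exact ⟨0, d, 0, by simp⟩
  | succ n ih =>
    obtain ⟨t, k, l, rfl, h1, h2, h3, h4⟩ := ih (by omega)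
    by_cases ht : n + 1 ≤ t
    · exact ⟨t, k, l, rfl, ht, by omega, h3, h4⟩
    obtain ⟨n', k', h5, h6, rfl, h7⟩ := hstep k (by omega)
    refine ⟨n' + t, k', l + 1, by omega, by omega, by omega, by linarith [add_one_mul l N], ?_⟩
    calc 2 ^ (l + 1) * A J (t + (n' + k')) = 2 * (2 ^ l * A J (t + (n' + k'))) := by ring
      _ ≤ 2 * (‖shiftProd w t (n' + k')‖ * A J (n' + k')) := by gcongr
      _ = ‖shiftProd w t (n' + k')‖ * (2 * A J (n' + k')) := by ring
      _ ≤ ‖shiftProd w t (n' + k')‖ * (‖shiftProd w n' k'‖ * A J k') := by gcongr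
      _ = ‖shiftProd w (n' + t) k'‖ * A J k' := by rw [norm_shiftProd_add]; ring

/-- One hop leads from the norm `m` to the norm `J`, then a doubling chain runs until it has passed
length `n` by at most `N`. The excess consists of at most `N` shifts and is absorbed by continuity,
which is where the norm `q` comes from. -/
lemma shiftGrowth_of_not_boundedRuns (hc : ShiftBounded A w) {J : ℕ}
    (h : ¬ ShiftBoundedRuns A w J) : ShiftGrowth A w := by
  unfold ShiftBoundedRuns at h
  push Not at h
  -- A constant above 1 rules out the trivial hop `n = 0`, so the chain really moves.
  obtain ⟨N, K, hK⟩ := h J 2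
  have hstep : ∀ d, K ≤ d → ∃ n k, 1 ≤ n ∧ n ≤ N ∧ n + k = d ∧
      2 * A J d ≤ ‖shiftProd w n k‖ * A J k := by
    intro d hd
    obtain ⟨n, k, h1, h2, h3⟩ := hK d hd
    refine ⟨n, k, ?_, h1, h2, h3.le⟩
    rcases Nat.eq_zero_or_pos n with rfl | hn
    · simp at h2 h3
      subst h2
      linarith [A.entry_pos J k]
    · exact hn
  have hN : 1 ≤ N := by
    obtain ⟨n, k, h1, h2, -⟩ := hstep K le_rfl
    omega
  obtain ⟨q, D, hD, hq⟩ := hc.iterate_le N J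
  refine ⟨q, fun m => ?_⟩
  obtain ⟨N', K', hK'⟩ := h m 1
  refine ⟨K + N + K', fun R => ?_⟩
  obtain ⟨l₀, hl₀⟩ := pow_unbounded_of_one_lt (R * D) (one_lt_two (α := ℝ))
  refine ⟨N' + l₀ * N, fun n hn kk hkk => ?_⟩
  obtain ⟨n₁, k₁, h1, h2, h3⟩ := hK' (n + kk) (by omega)
  obtain ⟨t, k, l, h4, h5, h6, h7, h8⟩ := exists_pow_chain hstep (n - n₁) k₁ (by omega)
  -- The chain has length at least `n - n₁ ≥ l₀ * N`, with hops of length at most `N`.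
  have hl : l₀ ≤ l := by
    by_contra hlt
    have : (l + 1) * N ≤ l₀ * N := Nat.mul_le_mul_right _ (by omega)
    have h9 := add_one_mul l N
    omega
  obtain ⟨i, hi⟩ : ∃ i, t + n₁ = i + n := ⟨t + n₁ - n, by omega⟩
  have hik : i + k = kk := by omega
  have e1 : ‖shiftProd w t k‖ * ‖shiftProd w n₁ k₁‖
      = ‖shiftProd w i k‖ * ‖shiftProd w n kk‖ := by
    rw [← h4, ← hik, ← norm_shiftProd_add, ← norm_shiftProd_add, hi]
  have e2 : 2 ^ l * A m (n + kk) ≤ D * (‖shiftProd w n kk‖ * A q kk) := by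
    calc 2 ^ l * A m (n + kk) ≤ 2 ^ l * (‖shiftProd w n₁ k₁‖ * A J k₁) := by
          gcongr; linarith
      _ = ‖shiftProd w n₁ k₁‖ * (2 ^ l * A J k₁) := by ring
      _ ≤ ‖shiftProd w n₁ k₁‖ * (‖shiftProd w t k‖ * A J k) := by gcongr
      _ = ‖shiftProd w n kk‖ * (‖shiftProd w i k‖ * A J k) := by linear_combination A J k * e1
      _ ≤ ‖shiftProd w n kk‖ * (D * A q (i + k)) := 
          mul_le_mul_of_nonneg_left (hq i (by omega) k) (norm_nonneg _)
      _ = D * (‖shiftProd w n kk‖ * A q kk) := by rw [hik]; ring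
  have e3 : R * D ≤ 2 ^ l := hl₀.le.trans (pow_le_pow_right₀ one_le_two hl)
  have e4 : R * D * A m (n + kk) ≤ 2 ^ l * A m (n + kk) :=
    mul_le_mul_of_nonneg_right e3 (A.entry_pos _ _).le
  exact le_of_mul_le_mul_left (by linarith) hD

/-- Blocks of one fixed length `N` each gain a factor `c > 1` in the norm `J`; a last block of
length `n'` passes to the norm `m`. This controls only special `n`, but in the norm `J` itself. -/
lemma frequently_growth_of_not_liminfLeOne {J : ℕ} (h : ¬ ShiftLiminfLeOne A w J) (m : ℕ) :
    ∃ K, ∀ (R : ℝ) (n₁ : ℕ), ∃ n, n₁ ≤ n ∧ ∀ k, K ≤ k →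
      R * A m (n + k) ≤ ‖shiftProd w n k‖ * A J k := by
  unfold ShiftLiminfLeOne at h
  push Not at h
  obtain ⟨N, hN, c, hc, K, hK⟩ := h J
  have hpow : ∀ l k, K ≤ k → c ^ l * A J (l * N + k) ≤ ‖shiftProd w (l * N) k‖ * A J k := by
    intro l
    induction l with
    | zero => intro k _; simp
    | succ l ih =>
      intro k hk
      have h1 := hK (l * N + k) (by omega)
      have h2 : (l + 1) * N + k = N + (l * N + k) := by ring
      calc c ^ (l + 1) * A J ((l + 1) * N + k) = c ^ l * (c * A J (N + (l * N + k))) := by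
            rw [h2]; ring
        _ ≤ c ^ l * (‖shiftProd w N (l * N + k)‖ * A J (l * N + k)) := by gcongr
        _ = ‖shiftProd w N (l * N + k)‖ * (c ^ l * A J (l * N + k)) := by ring
        _ ≤ ‖shiftProd w N (l * N + k)‖ * (‖shiftProd w (l * N) k‖ * A J k) := 
            mul_le_mul_of_nonneg_left (ih k hk) (norm_nonneg _)
        _ = ‖shiftProd w ((l + 1) * N) k‖ * A J k := by
            rw [add_one_mul, norm_shiftProd_add]; ring
  obtain ⟨n', hn', c', hc', K', hK'⟩ := h m
  refine ⟨K + K', fun R n₁ => ?_⟩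
  obtain ⟨l₀, hl₀⟩ := pow_unbounded_of_one_lt R hc
  refine ⟨max l₀ n₁ * N + n', ?_, fun k hk => ?_⟩
  · have := Nat.mul_le_mul (le_max_right l₀ n₁) hN
    omega
  have hl : l₀ ≤ max l₀ n₁ := le_max_left _ _
  generalize max l₀ n₁ = l at *
  have h1 := hK' (l * N + k) (by omega)
  have h3 : R ≤ c ^ l := hl₀.le.trans (pow_le_pow_right₀ hc.le hl)
  have h4 : l * N + n' + k = n' + (l * N + k) := by ring
  have hA := A.entry_pos m (n' + (l * N + k))
  calc R * A m (l * N + n' + k) ≤ c ^ l * A m (n' + (l * N + k)) := by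
        rw [h4]; gcongr
    _ ≤ c ^ l * (c' * A m (n' + (l * N + k))) := by gcongr; nlinarith
    _ ≤ c ^ l * (‖shiftProd w n' (l * N + k)‖ * A J (l * N + k)) := by gcongr
    _ = ‖shiftProd w n' (l * N + k)‖ * (c ^ l * A J (l * N + k)) := by ring
    _ ≤ ‖shiftProd w n' (l * N + k)‖ * (‖shiftProd w (l * N) k‖ * A J k) := 
        mul_le_mul_of_nonneg_left (hpow l k (by omega)) (norm_nonneg _)
    _ = ‖shiftProd w (l * N + n') k‖ * A J k := by rw [norm_shiftProd_add]; ring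

/-- A single iterate gaining `C + 1` at all far coordinates contradicts a bounded run with constant
`C`. -/
lemma shiftGrowth_of_not_liminfLeOne (hc : ShiftBounded A w) {J : ℕ}
    (h : ¬ ShiftLiminfLeOne A w J) : ShiftGrowth A w := by
  refine shiftGrowth_of_not_boundedRuns hc (J := J) ?_
  rintro ⟨m, C, hC⟩
  obtain ⟨K, hK⟩ := frequently_growth_of_not_liminfLeOne h m
  obtain ⟨n, -, hn⟩ := hK (C + 1) 0
  obtain ⟨d, hd, hd'⟩ := hC n (n + K)
  obtain ⟨k, rfl⟩ : ∃ k, d = n + k := ⟨d - n, by omega⟩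
  nlinarith [hd' n k le_rfl rfl, hn k (by omega), A.entry_pos m (n + k)]

/-- For `k < K` the product factors through the coordinate `K`, leaving `n - (K - k)` further
factors. Since this number varies with `k`, growth along special `n` is not enough and full
`ShiftGrowth` is used there. -/
lemma exists_forall_lt_of_not_liminfLeOne (hc : ShiftBounded A w) (hw : ∀ n, w n ≠ 0) {J : ℕ}
    (h : ¬ ShiftLiminfLeOne A w J) (m : ℕ) (C : ℝ) :
    ∃ n, 1 ≤ n ∧ ∀ k, C * A m (n + k) < ‖shiftProd w n k‖ * A J k := by
  obtain ⟨q, hq⟩ := shiftGrowth_of_not_liminfLeOne hc h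
  obtain ⟨K₁, hK₁⟩ := hq m
  obtain ⟨K₂, hK₂⟩ := frequently_growth_of_not_liminfLeOne h m
  set K := max K₁ K₂ with hKdef
  have hκ : ∃ κ : ℝ, 0 < κ ∧ ∀ k, k < K → κ * A q K ≤ ‖shiftProd w (K - k) k‖ * A J k := by
    have hpos : ∀ k, 0 < ‖shiftProd w (K - k) k‖ * A J k / A q K := fun k =>
      div_pos (mul_pos (norm_shiftProd_pos hw _ _) (A.entry_pos _ _)) (A.entry_pos _ _)
    obtain ⟨κ, h1, h2⟩ : ∃ κ : ℝ, 0 < κ ∧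
        ∀ k ∈ Finset.range K, κ ≤ ‖shiftProd w (K - k) k‖ * A J k / A q K := by
      rcases (Finset.range K).eq_empty_or_nonempty with he | hne
      · exact ⟨1, one_pos, by simp [he]⟩
      · obtain ⟨k₀, -, hk₀⟩ := (Finset.range K).exists_min_image
          (fun k => ‖shiftProd w (K - k) k‖ * A J k / A q K) hne
        exact ⟨_, hpos k₀, hk₀⟩
    refine ⟨κ, h1, fun k hk => ?_⟩
    have := h2 k (Finset.mem_range.2 hk)
    rwa [le_div_iff₀ (A.entry_pos _ _)] at this
  obtain ⟨κ, hκ0, hκ⟩ := hκ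
  obtain ⟨n₀, hn₀⟩ := hK₁ ((|C| + 1) / κ)
  obtain ⟨n, hn, hn'⟩ := hK₂ (|C| + 1) (n₀ + K + 1)
  have hlt : ∀ k, C * A m (n + k) < (|C| + 1) * A m (n + k) := fun k =>
    mul_lt_mul_of_pos_right (by linarith [le_abs_self C]) (A.entry_pos _ _)
  refine ⟨n, by omega, fun k => (hlt k).trans_le ?_⟩
  rcases le_or_gt K k with hk | hk
  · exact hn' k ((le_max_right _ _).trans hk)
  obtain ⟨r, hr⟩ : ∃ r, n = (K - k) + r := ⟨n - (K - k), by omega⟩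
  have h1 := hn₀ r (by omega) K (le_max_left _ _)
  have hkK : K - k + k = K := by omega
  have h2 : r + K = n + k := by omega
  rw [h2, div_mul_eq_mul_div, div_le_iff₀ hκ0] at h1
  calc (|C| + 1) * A m (n + k) ≤ ‖shiftProd w r K‖ * A q K * κ := h1
    _ = ‖shiftProd w r K‖ * (κ * A q K) := by ring
    _ ≤ ‖shiftProd w r K‖ * (‖shiftProd w (K - k) k‖ * A J k) := 
        mul_le_mul_of_nonneg_left (hκ k hk) (norm_nonneg _)
    _ = ‖shiftProd w n k‖ * A J k := by
      rw [hr, norm_shiftProd_add, hkK]; ring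

/-- What matters is the order of quantifiers: `C` does not depend on `n`, only the threshold for `k`
does. -/
lemma KotheMatrix.CondB.eventually_le {J : ℕ} (hA : A.CondB J) (m j : ℕ) :
    ∃ mj, ∃ C : ℝ, 0 < C ∧ ∀ n, ∀ᶠ k in atTop, A j k * A m (n + k) ≤ C * (A J k * A mj (n + k)) := by
  obtain ⟨mj, h⟩ := hA m j
  obtain ⟨C, hC, -⟩ := ENNReal.lt_iff_exists_nnreal_btwn.1 h
  refine ⟨mj, C + 1, by positivity, fun n => ?_⟩
  have h1 := (le_iSup (fun n : ℕ => limsup (fun k : ℕ =>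
      ENNReal.ofReal ((A j k * A m (n + k)) / (A J k * A mj (n + k)))) atTop) n).trans_lt hC
  filter_upwards [eventually_lt_of_limsup_lt h1] with k hk
  have hpos : 0 < A J k * A mj (n + k) := mul_pos (A.entry_pos _ _) (A.entry_pos _ _)
  rw [← ENNReal.ofReal_coe_nnreal, ENNReal.ofReal_lt_ofReal_iff'] at hk
  have h2 := (div_lt_iff₀ hpos).1 hk.1
  linarith

/-- The constant `C` of the norm exchange is known before `n`, so growth can be invoked with gain `2
* C`; a far `k` where the `n`-th product gains less than 2 then contradicts it. -/
lemma ShiftLiminfLeOne.not_growth {J : ℕ} (hA : A.CondB J) (h : ShiftLiminfLeOne A w J) :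
    ¬ ShiftGrowth A w := by
  rintro ⟨q, hq⟩
  obtain ⟨m, hm⟩ := h
  obtain ⟨mq, C, hC, hB⟩ := hA.eventually_le m q
  obtain ⟨K, hK⟩ := hq mq
  obtain ⟨n₀, hn₀⟩ := hK (2 * C)
  obtain ⟨K', hK'⟩ := eventually_atTop.1 (hB (n₀ + 1))
  obtain ⟨k, hk, hk'⟩ := hm (n₀ + 1) (by omega) 2 (by norm_num) (max K K')
  have h1 := hn₀ (n₀ + 1) (by omega) k ((le_max_left _ _).trans hk)
  have h2 := hK' k ((le_max_right _ _).trans hk)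
  have hJ := A.entry_pos J k
  have hqk := A.entry_pos q k
  have h3 : 2 * C * A mq (n₀ + 1 + k) * A J k
      < 2 * C * A mq (n₀ + 1 + k) * A J k :=
    calc 2 * C * A mq (n₀ + 1 + k) * A J k ≤ ‖shiftProd w (n₀ + 1) k‖ * A q k * A J k := by
          gcongr
      _ = (‖shiftProd w (n₀ + 1) k‖ * A J k) * A q k := by ring
      _ < (2 * A m (n₀ + 1 + k)) * A q k := by gcongr
      _ = 2 * (A q k * A m (n₀ + 1 + k)) := by ring
      _ ≤ 2 * (C * (A J k * A mq (n₀ + 1 + k))) := by gcongr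
      _ = 2 * C * A mq (n₀ + 1 + k) * A J k := by ring
  exact lt_irrefl _ h3

/-- For each `N` only finitely many pairs `(n, j)` occur, so their thresholds in `CondB` have a
common bound; `d` is taken at least `N` beyond it. -/
lemma ShiftBoundedRuns.forall_norm {J : ℕ} (hA : A.CondB J) (h : ShiftBoundedRuns A w J) :
    ∃ (mm : ℕ → ℕ) (C : ℕ → ℝ), (∀ j, 0 < C j) ∧ ∀ N K, ∃ d, K ≤ d ∧ ∀ n k j, n ≤ N → j ≤ N →
      n + k = d → ‖shiftProd w n k‖ * A j k ≤ C j * A (mm j) d := by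
  obtain ⟨m, C₀, h⟩ := h
  choose mm C hC hB using hA.eventually_le m
  refine ⟨mm, fun j => (|C₀| + 1) * C j, fun j => mul_pos (by positivity) (hC j), fun N K => ?_⟩
  have h1 : ∀ᶠ k in atTop, ∀ n ∈ Finset.range (N + 1), ∀ j ∈ Finset.range (N + 1),
      A j k * A m (n + k) ≤ C j * (A J k * A (mm j) (n + k)) :=
    (eventually_all_finset _).2 fun n _ => (eventually_all_finset _).2 fun j _ => hB j n
  obtain ⟨K', hK'⟩ := eventually_atTop.1 h1
  obtain ⟨d, hd, hd'⟩ := h N (K + K' + N)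
  refine ⟨d, by omega, fun n k j hn hj hnk => ?_⟩
  have h2 := hK' k (by omega) n (by simp; omega) j (by simp; omega)
  have h3 := hd' n k hn hnk
  rw [hnk] at h2
  have hJ := A.entry_pos J k
  have hjk := A.entry_pos j k
  have hm := A.entry_pos m d
  refine le_of_mul_le_mul_right (a := A J k) ?_ hJ
  calc ‖shiftProd w n k‖ * A j k * A J k = (‖shiftProd w n k‖ * A J k) * A j k := by ring
    _ ≤ (C₀ * A m d) * A j k := by gcongr
    _ ≤ ((|C₀| + 1) * A m d) * A j k := by gcongr; linarith [le_abs_self C₀]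
    _ = (|C₀| + 1) * (A j k * A m d) := by ring
    _ ≤ (|C₀| + 1) * (C j * (A J k * A (mm j) d)) := by gcongr
    _ = _ := by ring

end Conditions

/-! ### From the extended-real conditions to inequalities -/

section ShiftSup

variable {𝕜 : Type*} [NormedField 𝕜] {A : KotheMatrix} {w : ℕ → 𝕜} {J : ℕ}

lemma ShiftLiminfLeOne.exists_shiftSup_le (h : ShiftLiminfLeOne A w J) :
    ∃ m, shiftSup A w J m ≤ 1 := by
  obtain ⟨m, hm⟩ := h
  refine ⟨m, iSup₂_le fun n hn => ?_⟩
  refine le_of_forall_gt_imp_ge_of_dense fun c hc => ?_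
  rcases eq_or_ne c ⊤ with rfl | hc'
  · exact le_top
  lift c to NNReal using hc'
  obtain ⟨k, -, hk⟩ := hm n hn c (by exact_mod_cast hc) 0
  refine (iInf_le _ k).trans ?_
  rw [← ENNReal.ofReal_coe_nnreal]
  refine ENNReal.ofReal_le_ofReal ?_
  rw [← norm_shiftProd, div_le_iff₀ (A.entry_pos _ _)]
  exact hk.le

lemma liminfLeOne_of_shiftSup_lt_top (hc : ShiftBounded A w) (hw : ∀ n, w n ≠ 0)
    (h : ∃ m, shiftSup A w J m < ∞) : ShiftLiminfLeOne A w J := by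
  obtain ⟨m, hm⟩ := h
  by_contra hL
  obtain ⟨C, hC, -⟩ := ENNReal.lt_iff_exists_nnreal_btwn.1 hm
  obtain ⟨n, hn, hn'⟩ := exists_forall_lt_of_not_liminfLeOne hc hw hL m C
  refine absurd hC (not_lt.2 ?_)
  refine le_trans ?_ (le_iSup₂ n hn)
  refine le_iInf fun k => ?_
  rw [← ENNReal.ofReal_coe_nnreal]
  refine ENNReal.ofReal_le_ofReal ?_
  rw [← norm_shiftProd, le_div_iff₀ (A.entry_pos _ _)]
  exact (hn' k).le

end ShiftSup

/-! ### Köthe spaces over an abstract solid norm -/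

/-- A solid, shift-invariant norm on non-negative real sequences, with the properties shared by
the norms of `ℓ^p` and of `c_0`: the predicate `Mem` singles out the sequences of the space, and
nothing is required of sequences with negative terms. -/
structure SolidNorm where
  Mem : (ℕ → ℝ) → Prop
  norm : (ℕ → ℝ) → ℝ
  mono {u v : ℕ → ℝ} : (∀ k, 0 ≤ u k) → (∀ k, u k ≤ v k) → Mem v → Mem u ∧ norm u ≤ norm v
  tsum {u : ℕ → ℕ → ℝ} : (∀ i k, 0 ≤ u i k) → (∀ i, Mem (u i)) →
    Summable (fun i => norm (u i)) →
    Mem (fun k => ∑' i, u i k) ∧ norm (fun k => ∑' i, u i k) ≤ ∑' i, norm (u i)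
  add {u v : ℕ → ℝ} : (∀ k, 0 ≤ u k) → (∀ k, 0 ≤ v k) → Mem u → Mem v →
    Mem (fun k => u k + v k) ∧ norm (fun k => u k + v k) ≤ norm u + norm v
  smul {u : ℕ → ℝ} {c : ℝ} : 0 ≤ c → (∀ k, 0 ≤ u k) → Mem u →
    Mem (fun k => c * u k) ∧ norm (fun k => c * u k) = c * norm u
  single (k : ℕ) : Mem (Pi.single k 1) ∧ norm (Pi.single k 1) ≤ 1
  le_norm {u : ℕ → ℝ} : (∀ k, 0 ≤ u k) → Mem u → ∀ k, u k ≤ norm u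
  shiftRight {u : ℕ → ℝ} (n : ℕ) : (∀ k, 0 ≤ u k) → Mem u →
    Mem (fun c => if n ≤ c then u (c - n) else 0) ∧
      norm (fun c => if n ≤ c then u (c - n) else 0) ≤ norm u
  shiftLeft {u : ℕ → ℝ} (n : ℕ) : (∀ k, 0 ≤ u k) → Mem u →
    Mem (fun k => u (n + k)) ∧ norm (fun k => u (n + k)) ≤ norm u
  tail {u : ℕ → ℝ} : (∀ k, 0 ≤ u k) → Mem u →
    Tendsto (fun n => norm (fun k => if n ≤ k then u k else 0)) atTop (𝓝 0)

namespace SolidNorm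

variable (S : SolidNorm) {u : ℕ → ℝ}

lemma norm_nonneg (h0 : ∀ k, 0 ≤ u k) (hu : S.Mem u) : 0 ≤ S.norm u :=
  (h0 0).trans (S.le_norm h0 hu 0)

/-- Expanding in unit vectors of norm at most 1 embeds ℓ¹ contractively; explicit vectors are later
built by summability alone. -/
lemma mem_of_summable (h0 : ∀ k, 0 ≤ u k) (hu : Summable u) :
    S.Mem u ∧ S.norm u ≤ ∑' k, u k := by
  have hs0 : ∀ i k, (0 : ℝ) ≤ (Pi.single i 1 : ℕ → ℝ) k := fun i k => by
    by_cases h : k = i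
    · subst h; simp
    · simp [h]
  have h1 : ∀ i, S.Mem (fun k => u i * (Pi.single i 1 : ℕ → ℝ) k) ∧
      S.norm (fun k => u i * (Pi.single i 1 : ℕ → ℝ) k) ≤ u i := fun i => by
    obtain ⟨h2, h3⟩ := S.smul (h0 i) (hs0 i) (S.single i).1
    exact ⟨h2, h3.le.trans (mul_le_of_le_one_right (h0 i) (S.single i).2)⟩
  have h0' : ∀ i k, 0 ≤ u i * (Pi.single i 1 : ℕ → ℝ) k := fun i k => mul_nonneg (h0 i) (hs0 i k)
  have h2 : Summable fun i => S.norm (fun k => u i * (Pi.single i 1 : ℕ → ℝ) k) :=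
    Summable.of_nonneg_of_le (fun i => S.norm_nonneg (h0' i) (h1 i).1) (fun i => (h1 i).2) hu
  obtain ⟨h3, h4⟩ := S.tsum h0' (fun i => (h1 i).1) h2
  have h5 : (fun k => ∑' i, u i * (Pi.single i 1 : ℕ → ℝ) k) = u := by
    funext k
    rw [tsum_eq_single k fun i hi => by simp [hi.symm]]
    simp
  rw [h5] at h3 h4
  exact ⟨h3, h4.trans (h2.tsum_le_tsum (fun i => (h1 i).2) hu)⟩

lemma mem_tail (h0 : ∀ k, 0 ≤ u k) (hu : S.Mem u) (n : ℕ) :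
    S.Mem (fun k => if n ≤ k then u k else 0) :=
  (S.mono (fun k => by split_ifs; exacts [h0 k, le_rfl])
    (fun k => by split_ifs; exacts [le_rfl, h0 k]) hu).1

lemma exists_tail_lt (h0 : ∀ k, 0 ≤ u k) (hu : S.Mem u) {ε : ℝ} (hε : 0 < ε) :
    ∃ n₀, ∀ n, n₀ ≤ n → S.norm (fun k => if n ≤ k then u k else 0) < ε :=
  eventually_atTop.1 ((S.tail h0 hu).eventually (gt_mem_nhds hε))

end SolidNorm

/-- The sequence `(|x_k| a_{j,k})_k`. -/
def KotheMatrix.weight {𝕜 : Type*} [NormedField 𝕜] (A : KotheMatrix) (j : ℕ) (x : ℕ → 𝕜) :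
    ℕ → ℝ :=
  fun k => ‖x k‖ * A j k

lemma KotheMatrix.weight_nonneg {𝕜 : Type*} [NormedField 𝕜] (A : KotheMatrix) (j : ℕ)
    (x : ℕ → 𝕜) (k : ℕ) : 0 ≤ A.weight j x k :=
  mul_nonneg (norm_nonneg _) (A.entry_pos j k).le

/-- `X` is, through its coordinates `ι`, the Köthe space of the matrix `A` over the solid
norm `S`, with the topology generated by the seminorms `P j`. -/
structure IsKotheSpace {𝕜 X : Type*} [RCLike 𝕜] [AddCommGroup X] [Module 𝕜 X]
    [TopologicalSpace X] (S : SolidNorm) (A : KotheMatrix) (ι : X →ₗ[𝕜] (ℕ → 𝕜))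
    (P : SeminormFamily 𝕜 X ℕ) : Prop where
  injective : Function.Injective ι
  exists_iff : ∀ x, (∃ v, ι v = x) ↔ ∀ j, S.Mem (A.weight j x)
  seminorm_apply : ∀ j v, P j v = S.norm (A.weight j (ι v))
  withSeminorms : WithSeminorms P

namespace IsKotheSpace

variable {𝕜 X : Type*} [RCLike 𝕜] [AddCommGroup X] [Module 𝕜 X] [TopologicalSpace X]
  {S : SolidNorm} {A : KotheMatrix} {ι : X →ₗ[𝕜] (ℕ → 𝕜)} {P : SeminormFamily 𝕜 X ℕ}

lemma mem (h : IsKotheSpace S A ι P) (j : ℕ) (v : X) : S.Mem (A.weight j (ι v)) :=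
  (h.exists_iff _).1 ⟨v, rfl⟩ j

lemma coord_le (h : IsKotheSpace S A ι P) (j : ℕ) (v : X) (k : ℕ) : ‖ι v k‖ * A j k ≤ P j v := by
  rw [h.seminorm_apply]
  exact S.le_norm (A.weight_nonneg j _) (h.mem j v) k

lemma seminorm_mono (h : IsKotheSpace S A ι P) {i j : ℕ} (hij : i ≤ j) : P i ≤ P j := fun v => by
  rw [h.seminorm_apply, h.seminorm_apply]
  exact (S.mono (A.weight_nonneg i _)
    (fun k => mul_le_mul_of_nonneg_left (A.entry_mono hij k) (norm_nonneg _)) (h.mem j v)).2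

lemma seminorm_pos (h : IsKotheSpace S A ι P) (j : ℕ) {v : X} (hv : v ≠ 0) : 0 < P j v := by
  have h1 : ι v ≠ 0 := fun h2 => hv (h.injective (by rw [h2, map_zero]))
  obtain ⟨k, hk⟩ := Function.ne_iff.1 h1
  exact (mul_pos (norm_pos_iff.2 hk) (A.entry_pos j k)).trans_le (h.coord_le j v k)

lemma sup_le (h : IsKotheSpace S A ι P) (s : Finset ℕ) : s.sup P ≤ P (s.sup id) :=
  Finset.sup_le fun _ hi => h.seminorm_mono (Finset.le_sup (f := id) hi)

lemma exists_of_summable (h : IsKotheSpace S A ι P) {x : ℕ → 𝕜}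
    (hx : ∀ j, Summable (A.weight j x)) : ∃ v, ι v = x :=
  (h.exists_iff x).2 fun j => (S.mem_of_summable (A.weight_nonneg j x) (hx j)).1

lemma exists_single (h : IsKotheSpace S A ι P) (k : ℕ) : ∃ v, ι v = Pi.single k 1 :=
  h.exists_of_summable fun j => summable_of_ne_finset_zero (s := {k}) fun b hb => by
    have : b ≠ k := by simpa using hb
    simp [KotheMatrix.weight, this]

lemma seminorm_single_le (h : IsKotheSpace S A ι P) {k : ℕ} {v : X} (hv : ι v = Pi.single k 1)
    (j : ℕ) : P j v ≤ A j k := by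
  have hsum : ∀ b ∉ ({k} : Finset ℕ), A.weight j (ι v) b = 0 := fun b hb => by
    have : b ≠ k := by simpa using hb
    simp [KotheMatrix.weight, this, hv]
  rw [h.seminorm_apply]
  refine (S.mem_of_summable (A.weight_nonneg j _) (summable_of_ne_finset_zero hsum)).2.trans ?_
  rw [tsum_eq_sum hsum]
  simp [KotheMatrix.weight, hv]

lemma exists_ball_subset (h : IsKotheSpace S A ι P) {U : Set X} (hU : IsOpen U) {z : X}
    (hz : z ∈ U) : ∃ j, ∃ ε > 0, ∀ v, P j (v - z) < ε → v ∈ U := by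
  obtain ⟨s, r, hr, hs⟩ := (h.withSeminorms.isOpen_iff_mem_balls U).1 hU z hz
  refine ⟨s.sup id, r, hr, fun v hv => hs ?_⟩
  rw [Seminorm.mem_ball]
  exact (h.sup_le s _).trans_lt hv

lemma isOpen_ball (h : IsKotheSpace S A ι P) (j : ℕ) (z : X) (ε : ℝ) :
    IsOpen {v | P j (v - z) < ε} := by
  have := h.withSeminorms.topologicalAddGroup
  have h1 : Continuous (P j) := h.withSeminorms.continuous_seminorm j
  exact isOpen_lt (h1.comp (continuous_id.sub continuous_const)) continuous_const

lemma continuous_coord (h : IsKotheSpace S A ι P) (k : ℕ) : Continuous fun v => ι v k := by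
  have h1 : Continuous ((LinearMap.proj k : (ℕ → 𝕜) →ₗ[𝕜] 𝕜) ∘ₗ ι) := by
    refine h.withSeminorms.continuous_normedSpace_rng 𝕜 _
      ⟨{0}, ⟨(A 0 k)⁻¹, (inv_pos.2 (A.entry_pos 0 k)).le⟩, fun v => ?_⟩
    have := h.coord_le 0 v k
    rw [← le_div_iff₀ (A.entry_pos 0 k)] at this
    change ‖ι v k‖ ≤ (A 0 k)⁻¹ * (({0} : Finset ℕ).sup P) v
    rwa [Finset.sup_singleton, ← div_eq_inv_mul]
  exact h1

lemma exists_tsum (h : IsKotheSpace S A ι P) {x : ℕ → X} (hx : ∀ j, Summable fun i => P j (x i)) :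
    ∃ v, (∀ k, HasSum (fun i => ι (x i) k) (ι v k)) ∧ ∀ j, P j v ≤ ∑' i, P j (x i) := by
  have hsw : ∀ j k, Summable fun i => A.weight j (ι (x i)) k := fun j k =>
    Summable.of_nonneg_of_le (fun i => A.weight_nonneg j _ k) (fun i => h.coord_le j (x i) k) (hx j)
  have hsn : ∀ k, Summable fun i => ‖ι (x i) k‖ := fun k => by
    have := (hsw 0 k).mul_right (A 0 k)⁻¹
    simpa [KotheMatrix.weight, mul_assoc, (A.entry_pos 0 k).ne'] using this
  have key : ∀ j, S.Mem (A.weight j fun k => ∑' i, ι (x i) k) ∧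
      S.norm (A.weight j fun k => ∑' i, ι (x i) k) ≤ ∑' i, P j (x i) := fun j => by
    have hx' : Summable fun i => S.norm (A.weight j (ι (x i))) :=
      (hx j).congr fun i => h.seminorm_apply j _
    obtain ⟨h1, h2⟩ := S.tsum (fun i => A.weight_nonneg j (ι (x i))) (fun i => h.mem j _) hx'
    have h3 : ∀ k, A.weight j (fun k => ∑' i, ι (x i) k) k ≤ ∑' i, A.weight j (ι (x i)) k :=
      fun k => by
        simp only [KotheMatrix.weight, tsum_mul_right]
        exact mul_le_mul_of_nonneg_right (norm_tsum_le_tsum_norm (hsn k)) (A.entry_pos j k).le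
    obtain ⟨h4, h5⟩ := S.mono (A.weight_nonneg j _) h3 h1
    refine ⟨h4, h5.trans (h2.trans_eq ?_)⟩
    exact tsum_congr fun i => (h.seminorm_apply j _).symm
  obtain ⟨v, hv⟩ := (h.exists_iff _).2 fun j => (key j).1
  refine ⟨v, fun k => ?_, fun j => ?_⟩
  · rw [hv]
    exact (hsn k).of_norm.hasSum
  · rw [h.seminorm_apply, hv]
    exact (key j).2

/-- The form of completeness used for the gliding hump: the remainder is itself the coordinatewise
sum of a tail, so `exists_tsum` bounds its seminorms. -/
lemma exists_tendsto_sum (h : IsKotheSpace S A ι P) {x : ℕ → X}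
    (hx : ∀ j, Summable fun i => P j (x i)) :
    ∃ v, (∀ k, HasSum (fun i => ι (x i) k) (ι v k)) ∧
      Tendsto (fun n => ∑ i ∈ Finset.range n, x i) atTop (𝓝 v) := by
  obtain ⟨v, hv, -⟩ := h.exists_tsum hx
  refine ⟨v, hv, (h.withSeminorms.tendsto_nhds _ _).2 fun j ε hε => ?_⟩
  filter_upwards [(tendsto_sum_nat_add fun i => P j (x i)).eventually (gt_mem_nhds hε)] with n hn
  obtain ⟨v', hv', hP⟩ := h.exists_tsum (x := fun i => x (i + n))
    fun j => (summable_nat_add_iff n).2 (hx j)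
  have h1 : v' = v - ∑ i ∈ Finset.range n, x i := by
    refine h.injective (funext fun k => ?_)
    refine (hv' k).unique ?_
    have := (hasSum_nat_add_iff' n).2 (hv k)
    simpa using this
  rw [map_sub_rev, ← h1]
  exact (hP j).trans_lt hn

/-! ### Iterates of the weighted shift -/

section Shift

variable {B : X →L[𝕜] X} {w : ℕ → 𝕜}

lemma coord_iterate (hB : ∀ x k, ι (B x) k = w (k + 1) * ι x (k + 1)) (n : ℕ) (x : X) (k : ℕ) :
    ι (B^[n] x) k = shiftProd w n k * ι x (n + k) := by
  induction n generalizing k with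
  | zero => simp
  | succ n ih =>
    rw [Function.iterate_succ_apply', hB, ih, add_comm n 1, shiftProd_add, ← mul_assoc,
      show n + (k + 1) = 1 + n + k by ring, add_comm k 1]
    simp [shiftProd]

lemma shiftBounded (h : IsKotheSpace S A ι P)
    (hB : ∀ x k, ι (B x) k = w (k + 1) * ι x (k + 1)) : ShiftBounded A w := fun j => by
  have h1 : Continuous ((P j).comp (B : X →ₗ[𝕜] X)) :=
    (h.withSeminorms.continuous_seminorm j).comp B.continuous
  obtain ⟨s, C, hC, hs⟩ := Seminorm.bound_of_continuous h.withSeminorms _ h1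
  refine ⟨s.sup id, C, by positivity, fun k => ?_⟩
  obtain ⟨v, hv⟩ := h.exists_single (k + 1)
  have h2 := h.coord_le j (B v) k
  rw [hB, hv] at h2
  have h3 := hs v
  have h4 := (h.sup_le s v).trans (h.seminorm_single_le hv _)
  simp only [Pi.single_eq_same, mul_one] at h2
  refine h2.trans (h3.trans ?_)
  exact mul_le_mul_of_nonneg_left h4 C.2

/-- The space has no isolated points, so a dense orbit remains dense without its first `n₁` terms.
-/
lemma exists_iterate_near (h : IsKotheSpace S A ι P) {x : X} (hx : IsHypercyclicVector B x)
    (z : X) (j n₁ : ℕ) {ε : ℝ} (hε : 0 < ε) : ∃ n, n₁ ≤ n ∧ P j (B^[n] x - z) < ε := by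
  have := h.withSeminorms.topologicalAddGroup
  have := h.withSeminorms.continuousSMul
  have : T1Space X := h.withSeminorms.T1_of_separating fun v hv => ⟨0, (h.seminorm_pos 0 hv).ne'⟩
  have hne : Nontrivial X := by
    obtain ⟨v, hv⟩ := h.exists_single 0
    exact ⟨v, 0, fun h0 => by simpa [h0] using congrFun hv 0⟩
  have : ∀ v : X, (𝓝[≠] v).NeBot := Module.punctured_nhds_neBot 𝕜 X
  have hfin : ((fun n => B^[n] x) '' Set.Iio n₁).Finite := (Set.finite_Iio n₁).image _
  obtain ⟨y, ⟨⟨n, -, rfl⟩, hn⟩, hy⟩ := (Dense.sdiff_finite hx hfin).exists_mem_open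
    (h.isOpen_ball j z ε) ⟨z, by simpa using hε⟩
  exact ⟨n, not_lt.1 fun hlt => hn ⟨n, hlt, rfl⟩, hy⟩

/-- When an orbit comes near a vector with first coordinates 2, the products W(n,k) |x_{n+k}| are at
least 1, while the tail of x beyond n is small. -/
lemma inverseSmall (h : IsKotheSpace S A ι P) (hw : ∀ n, w n ≠ 0)
    (hB : ∀ x k, ι (B x) k = w (k + 1) * ι x (k + 1)) (hH : IsHypercyclicOperator B) :
    ShiftInverseSmall A w := by
  obtain ⟨x, hx⟩ := hH
  intro j K b ε hε
  obtain ⟨n₀, hn₀⟩ := S.exists_tail_lt (A.weight_nonneg j (ι x)) (h.mem j x) (half_pos hε)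
  obtain ⟨z, hz⟩ : ∃ z, ι z = fun k => if k < K then 2 else 0 :=
    h.exists_of_summable fun j => summable_of_ne_finset_zero (s := Finset.range K) fun k hk => by
      have : ¬ k < K := by simpa using hk
      simp [KotheMatrix.weight, this]
  obtain ⟨δ, hδ, hδ'⟩ : ∃ δ : ℝ, 0 < δ ∧ ∀ k, k < K → δ ≤ A 0 k := by
    rcases Nat.eq_zero_or_pos K with rfl | hK
    · exact ⟨1, one_pos, by simp⟩
    · obtain ⟨k₀, -, hk₀⟩ := (Finset.range K).exists_min_image (A 0) ⟨0, by simpa using hK⟩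
      exact ⟨_, A.entry_pos 0 k₀, fun k hk => hk₀ k (by simpa using hk)⟩
  obtain ⟨n, hn, hn'⟩ := h.exists_iterate_near hx z 0 (max b n₀) hδ
  refine ⟨n, (le_max_left _ _).trans hn, fun k hk => ?_⟩
  have h1 : ‖shiftProd w n k * ι x (n + k) - 2‖ < 1 := by
    have h2 := (h.coord_le 0 (B^[n] x - z) k).trans_lt (hn'.trans_le (hδ' k hk))
    rw [map_sub, Pi.sub_apply, coord_iterate hB, hz] at h2
    simp only [hk, if_true] at h2
    exact (mul_lt_iff_lt_one_left (A.entry_pos 0 k)).1 h2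
  have h3 : 1 ≤ ‖shiftProd w n k‖ * ‖ι x (n + k)‖ := by
    rw [← norm_mul]
    have h4 := norm_sub_norm_le (2 : 𝕜) (2 - shiftProd w n k * ι x (n + k))
    rw [norm_sub_rev (2 : 𝕜) (shiftProd w n k * ι x (n + k)), sub_sub_cancel,
      RCLike.norm_ofNat] at h4
    linarith
  have h5 := (S.le_norm (fun k => by split_ifs; exacts [A.weight_nonneg j _ k, le_rfl])
    (S.mem_tail (A.weight_nonneg j (ι x)) (h.mem j x) n) (n + k)).trans_lt
      (hn₀ n ((le_max_right _ _).trans hn))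
  simp only [Nat.le_add_right, if_true, KotheMatrix.weight] at h5
  have hW := norm_shiftProd_pos hw n k
  have hA := A.entry_pos j (n + k)
  calc A j (n + k) ≤ (‖shiftProd w n k‖ * ‖ι x (n + k)‖) * A j (n + k) :=
        le_mul_of_one_le_left hA.le h3
    _ = ‖shiftProd w n k‖ * (‖ι x (n + k)‖ * A j (n + k)) := by ring
    _ < ‖shiftProd w n k‖ * ε := by gcongr; linarith
    _ = ε * ‖shiftProd w n k‖ := mul_comm _ _

end Shift

end IsKotheSpace

/-! ### Growth excludes hypercyclic subspaces -/

namespace IsKotheSpace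

variable {𝕜 X : Type*} [RCLike 𝕜] [AddCommGroup X] [Module 𝕜 X] [TopologicalSpace X]
  {S : SolidNorm} {A : KotheMatrix} {ι : X →ₗ[𝕜] (ℕ → 𝕜)} {P : SeminormFamily 𝕜 X ℕ}
  {B : X →L[𝕜] X} {w : ℕ → 𝕜}

/-- The first `a` coordinates cannot separate the points of an infinite-dimensional space; a kernel
vector is rescaled. -/
lemma exists_mem_of_not_finiteDimensional (h : IsKotheSpace S A ι P) {M : Submodule 𝕜 X}
    (hM : ¬ FiniteDimensional 𝕜 M) (a j : ℕ) {r : ℝ} (hr : 0 < r) :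
    ∃ x ∈ M, (∀ k, k < a → ι x k = 0) ∧ P j x = r := by
  let φ : M →ₗ[𝕜] (Fin a → 𝕜) := LinearMap.pi fun k => LinearMap.proj (k : ℕ) ∘ₗ ι ∘ₗ M.subtype
  have hφ : ¬ Function.Injective φ := fun hi => hM (FiniteDimensional.of_injective φ hi)
  rw [← LinearMap.ker_eq_bot, Submodule.eq_bot_iff] at hφ
  push Not at hφ
  obtain ⟨x, hx, hx0⟩ := hφ
  have hx0' : (x : X) ≠ 0 := fun h0 => hx0 (Subtype.ext h0)
  have hP := h.seminorm_pos j hx0'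
  refine ⟨((r / P j x : ℝ) : 𝕜) • (x : X), M.smul_mem _ x.2, fun k hk => ?_, ?_⟩
  · have : ι (x : X) k = 0 := congrFun hx ⟨k, hk⟩
    simp [this]
  · rw [map_smul_eq_mul, RCLike.norm_ofReal, abs_of_nonneg (by positivity),
      div_mul_cancel₀ _ hP.ne']

/-- If the first coordinates of `x` before `a` vanish and the tail of `z` after `a` is small,
the part of `z + x + ⋯` supported in `[a, a')` forces the iterate of the sum to be large. -/
lemma one_le_seminorm_iterate (h : IsKotheSpace S A ι P)
    (hB : ∀ x k, ι (B x) k = w (k + 1) * ι x (k + 1)) {q j s a a' n : ℕ} {D : ℝ} (hD : 0 < D)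
    {z x y : X} (hlow : ∀ k, a ≤ n + k → 4 * 2 ^ j * A j (n + k) ≤ ‖shiftProd w n k‖ * A q k)
    (hup : ∀ k, ‖shiftProd w n k‖ * A q k ≤ D * A s (n + k)) (hna : n ≤ a)
    (hx0 : ∀ k, k < a → ι x k = 0) (hx : P j x = (1 / 2) ^ j)
    (hz : D * S.norm (fun k => if a ≤ k then A.weight s (ι z) k else 0) ≤ 1 / 2)
    (hxt : S.norm (fun k => if a' ≤ k then A.weight j (ι x) k else 0) ≤ (1 / 2) ^ j / 2)
    (hy : ∀ k, k < a' → ι y k = ι z k + ι x k) : 1 ≤ P q (B^[n] y) := by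
  have hz1 := S.mem_tail (A.weight_nonneg s (ι z)) (h.mem s z) a
  have hxt1 := S.mem_tail (A.weight_nonneg j (ι x)) (h.mem j x) a'
  have hz0 : ∀ k, 0 ≤ (if a ≤ k then A.weight s (ι z) k else 0) := fun k => by
    split_ifs; exacts [A.weight_nonneg s _ k, le_rfl]
  have hxt0 : ∀ k, 0 ≤ (if a' ≤ k then A.weight j (ι x) k else 0) := fun k => by
    split_ifs; exacts [A.weight_nonneg j _ k, le_rfl]
  obtain ⟨hv1, hv2⟩ := S.shiftRight n (A.weight_nonneg q (ι (B^[n] y))) (h.mem q (B^[n] y))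
  have hv0 : ∀ c, 0 ≤ (if n ≤ c then A.weight q (ι (B^[n] y)) (c - n) else 0) := fun k => by
    split_ifs; exacts [A.weight_nonneg q _ _, le_rfl]
  obtain ⟨hz2, hz3⟩ := S.smul hD.le hz0 hz1
  obtain ⟨hx2, hx3⟩ := S.smul (c := 4 * 2 ^ j) (by positivity) hxt0 hxt1
  have hz0' : ∀ k, 0 ≤ D * (if a ≤ k then A.weight s (ι z) k else 0) := fun k =>
    mul_nonneg hD.le (hz0 k)
  have hx0' : ∀ k, 0 ≤ 4 * 2 ^ j * (if a' ≤ k then A.weight j (ι x) k else 0) := fun k =>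
    mul_nonneg (by positivity) (hxt0 k)
  obtain ⟨h1, h2⟩ := S.add hv0 hz0' hv1 hz2
  obtain ⟨h3, h4⟩ := S.add (fun k => add_nonneg (hv0 k) (hz0' k)) hx0' h1 hx2
  obtain ⟨h5, h6⟩ := S.smul (c := 4 * 2 ^ j) (by positivity) (A.weight_nonneg j (ι x)) (h.mem j x)
  -- On `[a, a')` the vector `x` is `y - z`: the `y` part is the iterate shifted right by `n`, and
  -- the `z` part is bounded by continuity. Beyond `a'` the tail of `x` bounds itself.
  have key : ∀ c, 4 * 2 ^ j * A.weight j (ι x) c ≤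
      (if n ≤ c then A.weight q (ι (B^[n] y)) (c - n) else 0) +
        D * (if a ≤ c then A.weight s (ι z) c else 0) +
        4 * 2 ^ j * (if a' ≤ c then A.weight j (ι x) c else 0) := by
    intro c
    rcases lt_or_ge c a with hc | hc
    · have : A.weight j (ι x) c = 0 := by simp [KotheMatrix.weight, hx0 c hc]
      rw [this, mul_zero]
      exact add_nonneg (add_nonneg (hv0 c) (hz0' c)) (by simp)
    rcases le_or_gt a' c with hc' | hc'
    · have := add_nonneg (hv0 c) (hz0' c)
      rw [if_pos hc']
      linarith
    obtain ⟨k, rfl⟩ : ∃ k, c = n + k := ⟨c - n, by omega⟩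
    rw [if_pos (by omega), if_pos hc, if_neg (by omega), Nat.add_sub_cancel_left]
    simp only [KotheMatrix.weight, coord_iterate hB, hy _ hc', norm_mul]
    have h7 : ‖ι x (n + k)‖ ≤ ‖ι z (n + k) + ι x (n + k)‖ + ‖ι z (n + k)‖ := by
      have := norm_sub_le (ι z (n + k) + ι x (n + k)) (ι z (n + k))
      rwa [add_sub_cancel_left] at this
    have hW : 0 ≤ ‖shiftProd w n k‖ * A q k := mul_nonneg (norm_nonneg _) (A.entry_pos _ _).le
    calc 4 * 2 ^ j * (‖ι x (n + k)‖ * A j (n + k))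
        = ‖ι x (n + k)‖ * (4 * 2 ^ j * A j (n + k)) := by ring
      _ ≤ ‖ι x (n + k)‖ * (‖shiftProd w n k‖ * A q k) :=
          mul_le_mul_of_nonneg_left (hlow k hc) (norm_nonneg _)
      _ ≤ (‖ι z (n + k) + ι x (n + k)‖ + ‖ι z (n + k)‖) * (‖shiftProd w n k‖ * A q k) :=
          mul_le_mul_of_nonneg_right h7 hW
      _ = ‖shiftProd w n k‖ * ‖ι z (n + k) + ι x (n + k)‖ * A q k +
          ‖ι z (n + k)‖ * (‖shiftProd w n k‖ * A q k) := by ring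
      _ ≤ ‖shiftProd w n k‖ * ‖ι z (n + k) + ι x (n + k)‖ * A q k +
          ‖ι z (n + k)‖ * (D * A s (n + k)) := by
          gcongr ?_ + ?_
          · exact le_rfl
          · exact mul_le_mul_of_nonneg_left (hup k) (norm_nonneg _)
      _ = _ := by ring
  -- In norm this reads 4 ≤ p_q(B^n y) + 1/2 + 2.
  have h8 := (S.mono (fun c => mul_nonneg (by positivity) (A.weight_nonneg j (ι x) c)) key h3).2
  rw [h6, ← h.seminorm_apply, hx] at h8
  rw [← h.seminorm_apply] at hv2
  have h9 : (2 : ℝ) ^ j * (1 / 2) ^ j = 1 := by rw [← mul_pow]; norm_num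
  have h10 : 4 * 2 ^ j * S.norm (fun k => if a' ≤ k then A.weight j (ι x) k else 0) ≤ 2 := by
    calc _ ≤ 4 * 2 ^ j * ((1 / 2) ^ j / 2) :=
          mul_le_mul_of_nonneg_left hxt (by positivity)
      _ = 2 := by linear_combination 2 * h9
  have h11 : (4 : ℝ) * 2 ^ j * (1 / 2) ^ j = 4 := by linear_combination 4 * h9
  linarith

theorem not_hasHypercyclicSubspace (h : IsKotheSpace S A ι P)
    (hB : ∀ x k, ι (B x) k = w (k + 1) * ι x (k + 1)) (hG : ShiftGrowth A w) :
    ¬ HasHypercyclicSubspace B := by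
  rintro ⟨M, hMc, hMi, hM⟩
  obtain ⟨q, hq⟩ := hG
  choose K hK using hq
  choose t ht using fun j => hK j (4 * 2 ^ j)
  obtain ⟨T, hTmono, hT⟩ : ∃ T : ℕ → ℕ, StrictMono T ∧ ∀ j, t j ≤ T j := by
    refine ⟨fun j => ∑ i ∈ Finset.range (j + 1), (t i + 1), strictMono_nat_of_lt_succ fun j => ?_,
      fun j => ?_⟩
    · rw [Finset.sum_range_succ _ (j + 1)]
      omega
    · change t j ≤ ∑ i ∈ Finset.range (j + 1), (t i + 1)
      rw [Finset.sum_range_succ]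
      omega
  -- The block `x j` takes care of the times `T j ≤ n < T (j + 1)`; `s j` and `D j` bound all
  -- iterates up to that horizon.
  choose s D hD hs using fun j => (h.shiftBounded hB).iterate_le (T (j + 1)) q
  choose f hfM hf0 hfP using fun a j =>
    h.exists_mem_of_not_finiteDimensional hMi a j (r := (1 / 2) ^ j) (by positivity)
  have hnext : ∀ (a j : ℕ) (z : X), ∃ a', a < a' ∧ T (j + 2) + K (j + 1) ≤ a' ∧
      D (j + 1) * S.norm (fun k => if a' ≤ k then A.weight (s (j + 1)) (ι z) k else 0) ≤ 1 / 2 ∧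
      S.norm (fun k => if a' ≤ k then A.weight j (ι (f a j)) k else 0) ≤ (1 / 2) ^ j / 2 := by
    intro a j z
    obtain ⟨n₁, h1⟩ := S.exists_tail_lt (A.weight_nonneg (s (j + 1)) (ι z)) (h.mem _ z)
      (ε := 1 / 2 / D (j + 1)) (by have := hD (j + 1); positivity)
    obtain ⟨n₂, h2⟩ := S.exists_tail_lt (A.weight_nonneg j (ι (f a j))) (h.mem _ (f a j))
      (ε := (1 / 2) ^ j / 2) (by positivity)
    refine ⟨a + 1 + (T (j + 2) + K (j + 1)) + n₁ + n₂, by omega, by omega, ?_,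
      (h2 _ (by omega)).le⟩
    rw [mul_comm, ← le_div_iff₀ (hD _)]
    exact (h1 _ (by omega)).le
  choose g hg1 hg2 hg3 hg4 using hnext
  -- The state is the partial sum `z j` with the position `a j` before which the next block
  -- vanishes.
  let st : ℕ → X × ℕ := fun j => Nat.rec (0, T 1 + K 0)
    (fun j p => (p.1 + f p.2 j, g p.2 j (p.1 + f p.2 j))) j
  let z : ℕ → X := fun j => (st j).1
  let a : ℕ → ℕ := fun j => (st j).2
  let x : ℕ → X := fun j => f (a j) j
  have hz : ∀ j, z (j + 1) = z j + x j := fun j => rfl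
  have ha : ∀ j, a (j + 1) = g (a j) j (z (j + 1)) := fun j => rfl
  have hz0 : z 0 = 0 := rfl
  have hzsum : ∀ j, z j = ∑ i ∈ Finset.range j, x i := fun j => by
    induction j with
    | zero => simp [hz0]
    | succ j ih => rw [hz, ih, Finset.sum_range_succ]
  have hamono : StrictMono a := strictMono_nat_of_lt_succ fun j => by rw [ha]; exact hg1 _ _ _
  have haT : ∀ j, T (j + 1) + K j ≤ a j := fun j => by
    cases j with
    | zero => exact le_rfl
    | succ j => rw [ha]; exact hg2 _ _ _
  have hzt : ∀ j, D j * S.norm (fun k => if a j ≤ k then A.weight (s j) (ι (z j)) k else 0)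
      ≤ 1 / 2 := fun j => by
    cases j with
    | zero =>
      obtain ⟨h1, h2⟩ := S.mem_of_summable (u := fun _ => 0) (fun _ => le_rfl) summable_zero
      have h3 : (fun k => if a 0 ≤ k then A.weight (s 0) (ι (z 0)) k else 0) = fun _ => (0 : ℝ) := by
        funext k; simp [hz0, KotheMatrix.weight]
      rw [h3]
      have h4 := mul_le_mul_of_nonneg_left h2 (hD 0).le
      rw [tsum_zero, mul_zero] at h4
      linarith
    | succ j => rw [ha]; exact hg3 _ _ _
  have hxt : ∀ j, S.norm (fun k => if a (j + 1) ≤ k then A.weight j (ι (x j)) k else 0)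
      ≤ (1 / 2) ^ j / 2 := fun j => by rw [ha]; exact hg4 _ _ _
  have hsum : ∀ i, Summable fun j => P i (x j) := fun i => by
    rw [← summable_nat_add_iff i]
    refine Summable.of_nonneg_of_le (fun j => apply_nonneg _ _) (fun j => ?_)
      ((summable_nat_add_iff i).2 summable_geometric_two)
    exact (h.seminorm_mono (Nat.le_add_left i j) _).trans (hfP _ _).le
  obtain ⟨y, hy, hlim⟩ := h.exists_tendsto_sum hsum
  have hyM : y ∈ M := hMc.mem_of_tendsto hlim
    (Eventually.of_forall fun n => M.sum_mem fun i _ => hfM _ _)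
  have hyw : ∀ j k, k < a (j + 1) → ι y k = ι (z j) k + ι (x j) k := fun j k hk => by
    have h1 : ∑ i ∈ Finset.range (j + 1), ι (x i) k = ι y k := by
      refine (hasSum_sum_of_ne_finset_zero fun i hi => ?_).unique (hy k)
      have hi' : j + 1 ≤ i := by simpa using hi
      exact hf0 _ _ k (hk.trans_le (hamono.monotone hi'))
    rw [← h1, Finset.sum_range_succ, hzsum, map_sum, Finset.sum_apply]
  have hbig : ∀ n, T 0 ≤ n → 1 ≤ P q (B^[n] y) := by
    intro n hn
    obtain ⟨j, hj1, hj2⟩ : ∃ j, T j ≤ n ∧ n < T (j + 1) := by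
      have hex : ∃ j, n < T j := ⟨n + 1, lt_of_lt_of_le (Nat.lt_succ_self n) (hTmono.le_apply)⟩
      have h1 := Nat.find_spec hex
      have h2 : Nat.find hex ≠ 0 := fun h0 => by rw [h0] at h1; omega
      obtain ⟨j, hj⟩ := Nat.exists_eq_succ_of_ne_zero h2
      refine ⟨j, not_lt.1 (Nat.find_min hex (by omega)), ?_⟩
      rw [hj] at h1
      exact h1
    -- Since `a j ≥ T (j + 1) + K j` and `n < T (j + 1)`, a coordinate `n + k ≥ a j` has `k ≥ K j`,
    -- where the growth estimate applies.
    have h3 := haT j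
    refine h.one_le_seminorm_iterate hB (hD j) (fun k hk => ht j n ((hT j).trans hj1) k ?_)
      (hs j n hj2.le) (by omega) (hf0 (a j) j) (hfP _ _) (hzt j) (hxt j) (hyw j)
    omega
  have hy0 : y ≠ 0 := by
    rintro rfl
    have := hbig (T 0) le_rfl
    rw [Function.iterate_fixed (map_zero B), map_zero] at this
    linarith
  obtain ⟨n, hn, hn'⟩ := h.exists_iterate_near (hM y hyM hy0) 0 q (T 0) one_pos
  rw [sub_zero] at hn'
  linarith [hbig n hn]

end IsKotheSpace

/-! ### Inductive choice of targets and free coordinates -/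

section Stages

variable {𝕜 : Type*} [NormedField 𝕜]

/-- The data of the inductive construction of a hypercyclic subspace. Stage `s` occupies the
coordinates `b s, …, d s`; the finitely supported target `y s` is realised by the `n s`-th
iterate through small entries between `n s` and `d s`, and the coordinate `d s` is free. -/
structure ShiftStages (A : KotheMatrix) (w : ℕ → 𝕜) (mm : ℕ → ℕ) (C : ℕ → ℝ) (L : ℕ → ℕ)
    (y : ℕ → ℕ → 𝕜) where
  b : ℕ → ℕ
  n : ℕ → ℕ
  d : ℕ → ℕ
  δ : ℕ → ℝ
  b_zero : b 0 = 0
  b_succ : ∀ s, b (s + 1) = d s + 1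
  b_le_n : ∀ s, b s ≤ n s
  n_add_le_d : ∀ s, n s + L s ≤ d s
  δ_le : ∀ i s, i < s → δ s ≤ A 0 (d i)
  small : ∀ s i j k l, i ≤ b s → j ≤ s → i + l = n s + k →
    ‖y s k‖ * (‖shiftProd w i l‖ * A j l) ≤ (1 / 2) ^ s * (1 / 2) ^ k * δ s * ‖shiftProd w (n s) k‖
  good : ∀ s i k j, i ≤ n s → j ≤ s → i + k = d s →
    ‖shiftProd w i k‖ * A j k ≤ C j * A (mm j) (d s)

variable {A : KotheMatrix} {w : ℕ → 𝕜} {mm : ℕ → ℕ} {C : ℕ → ℝ} {L : ℕ → ℕ} {y : ℕ → ℕ → 𝕜}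

/-- Continuity of the iterates up to `b` fixes `q` and `D`, then `ShiftInverseSmall` in the norm `q`
gives `n`, and only then is `d` chosen, good for all iterates up to `n`. -/
lemma exists_shiftStage (hc : ShiftBounded A w) (hs : ShiftInverseSmall A w)
    (hC : ∀ N K, ∃ d, K ≤ d ∧ ∀ n k j, n ≤ N → j ≤ N → n + k = d →
      ‖shiftProd w n k‖ * A j k ≤ C j * A (mm j) d)
    (hy : ∀ s k, L s ≤ k → y s k = 0) (s b : ℕ) {δ : ℝ} (hδ : 0 < δ) :
    ∃ n d, b ≤ n ∧ n + L s ≤ d ∧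
      (∀ i j k l, i ≤ b → j ≤ s → i + l = n + k → ‖y s k‖ * (‖shiftProd w i l‖ * A j l) ≤
        (1 / 2) ^ s * (1 / 2) ^ k * δ * ‖shiftProd w n k‖) ∧
      ∀ i k j, i ≤ n → j ≤ s → i + k = d → ‖shiftProd w i k‖ * A j k ≤ C j * A (mm j) d := by
  obtain ⟨q, D, hD, hq⟩ := hc.iterate_le b s
  set Y : ℝ := ∑ k ∈ Finset.range (L s), ‖y s k‖ + 1 with hYdef
  have hY : 0 < Y := by positivity
  -- Chosen to cancel the iterate bound `D` and the size `Y` of the target; `(1 / 2) ^ L s` serves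
  -- for all `k < L s` at once.
  set ε : ℝ := (1 / 2) ^ s * (1 / 2) ^ L s * δ / (D * Y) with hε
  obtain ⟨n, hn, hn'⟩ := hs q (L s) b ε (by positivity)
  obtain ⟨d, hd, hd'⟩ := hC (n + s) (n + L s)
  refine ⟨n, d, hn, hd, fun i j k l hi hj hl => ?_, fun i k j hi hj hk =>
    hd' i k j (by omega) (by omega) hk⟩
  rcases le_or_gt (L s) k with hk | hk
  · rw [hy s k hk, norm_zero, zero_mul]
    positivity
  have h1 : ‖y s k‖ ≤ Y := by
    have := Finset.single_le_sum (f := fun k => ‖y s k‖) (fun k _ => norm_nonneg _)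
      (Finset.mem_range.2 hk)
    linarith
  have h2 : ‖shiftProd w i l‖ * A j l ≤ D * (ε * ‖shiftProd w n k‖) := by
    calc ‖shiftProd w i l‖ * A j l ≤ ‖shiftProd w i l‖ * A s l :=
          mul_le_mul_of_nonneg_left (A.entry_mono hj l) (norm_nonneg _)
      _ ≤ D * A q (i + l) := hq i hi l
      _ ≤ D * (ε * ‖shiftProd w n k‖) := by
          rw [hl]; exact mul_le_mul_of_nonneg_left (hn' k hk).le hD.le
  calc ‖y s k‖ * (‖shiftProd w i l‖ * A j l) ≤ Y * (D * (ε * ‖shiftProd w n k‖)) :=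
        mul_le_mul h1 h2 (mul_nonneg (norm_nonneg _) (A.entry_pos _ _).le) hY.le
    _ = (1 / 2) ^ s * (1 / 2) ^ L s * δ * ‖shiftProd w n k‖ := by
        rw [hε]; field_simp
    _ ≤ (1 / 2) ^ s * (1 / 2) ^ k * δ * ‖shiftProd w n k‖ := by
        have : ((1 : ℝ) / 2) ^ L s ≤ (1 / 2) ^ k :=
          pow_le_pow_of_le_one (by norm_num) (by norm_num) hk.le
        gcongr

lemma exists_shiftStages (hc : ShiftBounded A w) (hs : ShiftInverseSmall A w)
    (hC : ∀ N K, ∃ d, K ≤ d ∧ ∀ n k j, n ≤ N → j ≤ N → n + k = d →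
      ‖shiftProd w n k‖ * A j k ≤ C j * A (mm j) d)
    (hy : ∀ s k, L s ≤ k → y s k = 0) : Nonempty (ShiftStages A w mm C L y) := by
  choose n d h1 h2 h3 h4 using fun (s : ℕ) (p : ℕ × {δ : ℝ // 0 < δ}) =>
    exists_shiftStage hc hs hC hy s p.1 p.2.2
  -- `δ` is the running minimum of the entries `A 0 (d i)` at the free coordinates chosen so far.
  let st : ℕ → ℕ × {δ : ℝ // 0 < δ} := fun s => Nat.rec (0, ⟨1, one_pos⟩)
    (fun s p => (d s p + 1, ⟨min p.2 (A 0 (d s p)), lt_min p.2.2 (A.entry_pos _ _)⟩)) s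
  have hst : ∀ s, st (s + 1) = (d s (st s) + 1,
    ⟨min (st s).2 (A 0 (d s (st s))), lt_min (st s).2.2 (A.entry_pos _ _)⟩) := fun s => rfl
  refine ⟨{ b := fun s => (st s).1, n := fun s => n s (st s), d := fun s => d s (st s),
            δ := fun s => (st s).2, b_zero := rfl, b_succ := fun s => by rw [hst],
            b_le_n := fun s => h1 s _, n_add_le_d := fun s => h2 s _, δ_le := fun i s his => ?_,
            small := fun s => h3 s _, good := fun s => h4 s _ }⟩
  induction s with
  | zero => omega
  | succ s ih =>
    rw [hst]
    rcases Nat.lt_succ_iff_lt_or_eq.1 his with h | rfl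
    · exact (min_le_left _ _).trans (ih h)
    · exact min_le_right _ _

namespace ShiftStages

variable (Φ : ShiftStages A w mm C L y)

lemma b_strictMono : StrictMono Φ.b := strictMono_nat_of_lt_succ fun s => by
  have := Φ.b_le_n s
  have := Φ.n_add_le_d s
  rw [Φ.b_succ]
  omega

/-- The stage to which the coordinate `c` belongs. -/
def stage (c : ℕ) : ℕ := Nat.findGreatest (fun s => Φ.b s ≤ c) c

lemma b_stage_le (c : ℕ) : Φ.b (Φ.stage c) ≤ c :=
  Nat.findGreatest_spec (P := fun s => Φ.b s ≤ c) (Nat.zero_le c) (by rw [Φ.b_zero]; exact c.zero_le)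

lemma le_stage {s c : ℕ} (h : Φ.b s ≤ c) : s ≤ Φ.stage c :=
  Nat.le_findGreatest (Φ.b_strictMono.le_apply.trans h) h

lemma stage_eq {s c : ℕ} (h : Φ.b s ≤ c) (h' : c ≤ Φ.d s) : Φ.stage c = s := by
  refine le_antisymm ?_ (Φ.le_stage h)
  by_contra! hlt
  have h1 := (Φ.b_strictMono.monotone (Nat.succ_le_of_lt hlt)).trans (Φ.b_stage_le c)
  rw [Nat.succ_eq_add_one, Φ.b_succ] at h1
  omega

lemma stage_d (s : ℕ) : Φ.stage (Φ.d s) = s := by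
  have := Φ.b_le_n s
  have := Φ.n_add_le_d s
  exact Φ.stage_eq (by omega) le_rfl

/-- The coefficient by which a coordinate that is not free depends on a free one. -/
def coeff (c : ℕ) : 𝕜 :=
  if Φ.n (Φ.stage c) ≤ c then
    y (Φ.stage c) (c - Φ.n (Φ.stage c)) / shiftProd w (Φ.n (Φ.stage c)) (c - Φ.n (Φ.stage c))
  else 0

/-- A summable sequence that dominates the coefficients. -/
def bound (c : ℕ) : ℝ :=
  (1 / 2) ^ Φ.stage c * (1 / 2) ^ ((c : ℤ) - Φ.n (Φ.stage c)).natAbs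

lemma bound_nonneg (c : ℕ) : 0 ≤ Φ.bound c := by unfold bound; positivity

/-- A coordinate is determined by its stage and its signed distance to `n` of that stage, so the sum
is part of a product of geometric series over ℕ × ℤ. -/
lemma summable_bound : Summable Φ.bound := by
  have h1 : Summable fun z : ℤ => ((1 : ℝ) / 2) ^ z.natAbs :=
    Summable.of_nat_of_neg (by simpa using summable_geometric_two)
      (by simpa using summable_geometric_two)
  have h2 : Summable fun p : ℕ × ℤ => ((1 : ℝ) / 2) ^ p.1 * (1 / 2) ^ p.2.natAbs :=
    summable_geometric_two.mul_of_nonneg h1 (fun _ => by positivity) (fun _ => by positivity)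
  refine h2.comp_injective (i := fun c : ℕ => (Φ.stage c, (c : ℤ) - Φ.n (Φ.stage c))) ?_
  intro c c' hcc
  simp only [Prod.mk.injEq] at hcc
  obtain ⟨h3, h4⟩ := hcc
  rw [h3] at h4
  omega

lemma norm_coeff_mul_le (hw : ∀ n, w n ≠ 0) {i j l c : ℕ} (hi : i ≤ Φ.b (Φ.stage c))
    (hj : j ≤ Φ.stage c) (hl : i + l = c) :
    ‖Φ.coeff c‖ * (‖shiftProd w i l‖ * A j l) ≤ Φ.bound c * Φ.δ (Φ.stage c) := by
  have hδ : 0 ≤ Φ.δ (Φ.stage c) := by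
    have h1 := Φ.small (Φ.stage c) 0 0 0 _ (Nat.zero_le _) (Nat.zero_le _) (Nat.zero_add _)
    have h2 := norm_shiftProd_pos hw (Φ.n (Φ.stage c)) 0
    have h3 := (mul_nonneg (norm_nonneg _) (mul_nonneg (norm_nonneg _) (A.entry_pos _ _).le)).trans h1
    have h4 := nonneg_of_mul_nonneg_left h3 h2
    exact nonneg_of_mul_nonneg_right h4 (by positivity)
  unfold coeff bound
  split_ifs with hn
  · obtain ⟨k, hk⟩ : ∃ k, c = Φ.n (Φ.stage c) + k := ⟨c - Φ.n (Φ.stage c), by omega⟩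
    have h1 := Φ.small (Φ.stage c) i j k l hi hj (by omega)
    have h2 : c - Φ.n (Φ.stage c) = k := by omega
    have h3 : ((c : ℤ) - Φ.n (Φ.stage c)).natAbs = k := by omega
    rw [h2, h3, norm_div, div_mul_eq_mul_div, div_le_iff₀ (norm_shiftProd_pos hw _ _)]
    exact h1
  · rw [norm_zero, zero_mul]
    positivity

end ShiftStages

end Stages

/-! ### The hypercyclic subspace -/

namespace IsKotheSpace

variable {𝕜 X : Type*} [RCLike 𝕜] [AddCommGroup X] [Module 𝕜 X] [TopologicalSpace X]
  {S : SolidNorm} {A : KotheMatrix} {ι : X →ₗ[𝕜] (ℕ → 𝕜)} {P : SeminormFamily 𝕜 X ℕ}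
  {B : X →L[𝕜] X} {w : ℕ → 𝕜} {mm : ℕ → ℕ} {C : ℕ → ℝ} {L : ℕ → ℕ} {y : ℕ → ℕ → 𝕜}

/-- The subspace of the vectors whose coordinates other than the free ones `d s` are determined
by the free ones; the target of the stage `s` is attached to the free coordinate of the
stage `e s`. -/
def _root_.ShiftStages.subspace (Φ : ShiftStages A w mm C L y) (ι : X →ₗ[𝕜] (ℕ → 𝕜)) (e : ℕ → ℕ) :
    Submodule 𝕜 X where
  carrier := {x | ∀ c, c ≠ Φ.d (Φ.stage c) →
    ι x c = Φ.coeff c * ι x (Φ.d (e (Φ.stage c)))}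
  add_mem' {x x'} hx hx' c hc := by
    rw [map_add, Pi.add_apply, Pi.add_apply, hx c hc, hx' c hc, mul_add]
  zero_mem' c _ := by simp
  smul_mem' a x hx c hc := by
    rw [map_smul, Pi.smul_apply, Pi.smul_apply, hx c hc, smul_eq_mul, smul_eq_mul]
    ring

variable (Φ : ShiftStages A w mm C L y) (e : ℕ → ℕ)

lemma isClosed_subspace (h : IsKotheSpace S A ι P) : IsClosed (Φ.subspace ι e : Set X) := by
  have h1 : (Φ.subspace ι e : Set X) = ⋂ c, {x | c ≠ Φ.d (Φ.stage c) →
      ι x c = Φ.coeff c * ι x (Φ.d (e (Φ.stage c)))} := by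
    ext x
    simp only [Set.mem_iInter]
    rfl
  rw [h1]
  refine isClosed_iInter fun c => ?_
  by_cases hc : c = Φ.d (Φ.stage c)
  · have : {x | c ≠ Φ.d (Φ.stage c) → ι x c = Φ.coeff c * ι x (Φ.d (e (Φ.stage c)))} = Set.univ :=
      Set.eq_univ_of_forall fun x hx => absurd hc hx
    rw [this]
    exact isClosed_univ
  · simp only [ne_eq, hc, not_false_eq_true, forall_const]
    exact isClosed_eq (h.continuous_coord c) (continuous_const.mul (h.continuous_coord _))

/-- Free coordinates may be prescribed: with only the `i`-th equal to 1, the dependent coordinates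
are coefficients, dominated in the norm `j` from stage `i + j + 1` on. -/
lemma exists_mem_subspace (h : IsKotheSpace S A ι P) (hw : ∀ n, w n ≠ 0) (i : ℕ) :
    ∃ x ∈ Φ.subspace ι e, ∀ s, ι x (Φ.d s) = if s = i then 1 else 0 := by
  set f : ℕ → 𝕜 := fun c => if c = Φ.d (Φ.stage c) then (if Φ.stage c = i then 1 else 0) else
    (if e (Φ.stage c) = i then Φ.coeff c else 0) with hf
  have hfd : ∀ s, f (Φ.d s) = if s = i then 1 else 0 := fun s => by simp [hf, Φ.stage_d]
  obtain ⟨x, hx⟩ : ∃ x, ι x = f := h.exists_of_summable fun j => by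
    refine Summable.of_norm_bounded_eventually_nat (Φ.summable_bound.mul_right (A 0 (Φ.d i))) ?_
    filter_upwards [eventually_ge_atTop (Φ.b (i + j + 1))] with c hc
    have hs := Φ.le_stage hc
    rw [Real.norm_of_nonneg (A.weight_nonneg j f c)]
    have h0 : 0 ≤ Φ.bound c * A 0 (Φ.d i) := mul_nonneg (Φ.bound_nonneg c) (A.entry_pos _ _).le
    have hle : ‖Φ.coeff c‖ * A j c ≤ Φ.bound c * A 0 (Φ.d i) := by
      have := Φ.norm_coeff_mul_le hw (i := 0) (j := j) (l := c) (c := c) (Nat.zero_le _) (by omega)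
        (by omega)
      rw [shiftProd_zero, norm_one, one_mul] at this
      exact this.trans (mul_le_mul_of_nonneg_left (Φ.δ_le i _ (by omega)) (Φ.bound_nonneg c))
    have hsi : Φ.stage c ≠ i := by omega
    simp only [KotheMatrix.weight, hf, hsi, if_false]
    split_ifs
    · simpa using h0
    · exact hle
    · simpa using h0
  refine ⟨x, fun c hc => ?_, fun s => by rw [hx, hfd]⟩
  rw [hx, hfd]
  simp only [hf, if_neg hc]
  split_ifs <;> simp

lemma not_finiteDimensional_subspace (h : IsKotheSpace S A ι P) (hw : ∀ n, w n ≠ 0) :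
    ¬ FiniteDimensional 𝕜 (Φ.subspace ι e) := by
  intro hfin
  choose x hx hxd using h.exists_mem_subspace Φ e hw
  have hli : LinearIndependent 𝕜 fun i => (⟨x i, hx i⟩ : Φ.subspace ι e) := by
    rw [linearIndependent_iff']
    intro s g hg i hi
    have h1 := congrArg (fun v : Φ.subspace ι e => ι (v : X) (Φ.d i)) hg
    simp only [Submodule.coe_sum, Submodule.coe_smul, map_sum, map_smul, Finset.sum_apply,
      Pi.smul_apply, hxd, smul_eq_mul, mul_ite, mul_one, mul_zero, Finset.sum_ite_eq, hi, if_true,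
      Submodule.coe_zero, map_zero, Pi.zero_apply] at h1
    exact h1
  exact Module.Finite.not_linearIndependent_of_infinite _ hli

lemma exists_free_coord_ne_zero (h : IsKotheSpace S A ι P) {x : X} (hx : x ∈ Φ.subspace ι e)
    (hx0 : x ≠ 0) : ∃ i, ι x (Φ.d i) ≠ 0 := by
  by_contra! hall
  refine hx0 (h.injective (funext fun c => ?_))
  rw [map_zero, Pi.zero_apply]
  by_cases hc : c = Φ.d (Φ.stage c)
  · rw [hc, hall]
  · rw [hx c hc, hall, mul_zero]

/-- A free coordinate is handled by `good`; dependent ones of stage `r` reproduce the target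
exactly; in later stages the coefficient carries `δ`, and δ |x_{d i}| ≤ a_{0,d i} |x_{d i}| ≤
p_0(x). The bound is a fixed sequence of the space read from index `n r` on, hence small for large
`r`. -/
lemma norm_iterate_sub_target_le (h : IsKotheSpace S A ι P) (hw : ∀ n, w n ≠ 0)
    (hC : ∀ j, 0 < C j) (hy : ∀ s k, L s ≤ k → y s k = 0) (he : ∀ s, ¬ e s < s → y s = 0) {x : X}
    (hx : x ∈ Φ.subspace ι e) {r j : ℕ} (hj : j ≤ r) (k : ℕ) :
    ‖shiftProd w (Φ.n r) k * ι x (Φ.n r + k) - ι x (Φ.d (e r)) * y r k‖ * A j k ≤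
      C j * A.weight (mm j) (ι x) (Φ.n r + k) + P 0 x * Φ.bound (Φ.n r + k) := by
  obtain ⟨c, hc⟩ : ∃ c, c = Φ.n r + k := ⟨_, rfl⟩
  rw [← hc]
  have hbn := Φ.b_le_n r
  have hnd := Φ.n_add_le_d r
  have hrs : r ≤ Φ.stage c := Φ.le_stage (by omega)
  have hbs := Φ.b_stage_le c
  have hW0 : 0 ≤ C j * A.weight (mm j) (ι x) c :=
    mul_nonneg (hC j).le (A.weight_nonneg _ _ _)
  have hB0 : 0 ≤ P 0 x * Φ.bound c := mul_nonneg (apply_nonneg _ _) (Φ.bound_nonneg c)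
  have hlt : r < Φ.stage c → Φ.d r < Φ.b (Φ.stage c) := fun hlt => by
    have := Φ.b_strictMono.monotone (Nat.succ_le_of_lt hlt)
    rw [Nat.succ_eq_add_one, Φ.b_succ] at this
    omega
  by_cases hcd : c = Φ.d (Φ.stage c)
  · have hy0 : y r k = 0 := by
      refine hy r k ?_
      rcases hrs.eq_or_lt with heq | hlt'
      · rw [← heq] at hcd; omega
      · have := hlt hlt'; omega
    have hns : Φ.n r ≤ Φ.n (Φ.stage c) := by
      rcases hrs.eq_or_lt with heq | hlt'
      · rw [← heq]
      · have := hlt hlt'; have := Φ.b_le_n (Φ.stage c); omega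
    have h1 := Φ.good (Φ.stage c) (Φ.n r) k j hns (hj.trans hrs) (by omega)
    rw [← hcd] at h1
    have h2 : ‖shiftProd w (Φ.n r) k * ι x c - ι x (Φ.d (e r)) * y r k‖ * A j k ≤
        C j * A.weight (mm j) (ι x) c := by
      rw [hy0, mul_zero, sub_zero, norm_mul, KotheMatrix.weight]
      calc ‖shiftProd w (Φ.n r) k‖ * ‖ι x c‖ * A j k
          = ‖ι x c‖ * (‖shiftProd w (Φ.n r) k‖ * A j k) := by ring
        _ ≤ ‖ι x c‖ * (C j * A (mm j) c) := mul_le_mul_of_nonneg_left h1 (norm_nonneg _)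
        _ = _ := by ring
    linarith
  rcases hrs.eq_or_lt with heq | hlt'
  · have h1 : shiftProd w (Φ.n r) k * ι x c - ι x (Φ.d (e r)) * y r k = 0 := by
      rw [hx c hcd, ShiftStages.coeff, ← heq, if_pos (by omega), hc, Nat.add_sub_cancel_left]
      have := shiftProd_ne_zero hw (Φ.n r) k
      field_simp
      ring
    rw [h1, norm_zero, zero_mul]
    linarith
  have hdb := hlt hlt'
  have hy0 : y r k = 0 := hy r k (by omega)
  rw [hy0, mul_zero, sub_zero, hx c hcd]
  by_cases hes : e (Φ.stage c) < Φ.stage c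
  · have h1 := Φ.norm_coeff_mul_le hw (i := Φ.n r) (j := j) (l := k) (c := c) (by omega)
      (hj.trans hrs) hc.symm
    have h2 := Φ.δ_le _ _ hes
    have h3 := h.coord_le 0 x (Φ.d (e (Φ.stage c)))
    have h4 : ‖shiftProd w (Φ.n r) k * (Φ.coeff c * ι x (Φ.d (e (Φ.stage c))))‖ * A j k ≤
        P 0 x * Φ.bound c := by
      calc _ = (‖Φ.coeff c‖ * (‖shiftProd w (Φ.n r) k‖ * A j k)) *
            ‖ι x (Φ.d (e (Φ.stage c)))‖ := by rw [norm_mul, norm_mul]; ring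
        _ ≤ (Φ.bound c * Φ.δ (Φ.stage c)) * ‖ι x (Φ.d (e (Φ.stage c)))‖ :=
            mul_le_mul_of_nonneg_right h1 (norm_nonneg _)
        _ ≤ (Φ.bound c * A 0 (Φ.d (e (Φ.stage c)))) * ‖ι x (Φ.d (e (Φ.stage c)))‖ :=
            mul_le_mul_of_nonneg_right (mul_le_mul_of_nonneg_left h2 (Φ.bound_nonneg c))
              (norm_nonneg _)
        _ = (‖ι x (Φ.d (e (Φ.stage c)))‖ * A 0 (Φ.d (e (Φ.stage c)))) * Φ.bound c := by ring
        _ ≤ P 0 x * Φ.bound c := mul_le_mul_of_nonneg_right h3 (Φ.bound_nonneg c)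
    linarith
  · have h1 : Φ.coeff c = 0 := by simp [ShiftStages.coeff, he _ hes]
    rw [h1, zero_mul, mul_zero, norm_zero, zero_mul]
    linarith

lemma exists_target_near (h : IsKotheSpace S A ι P) {val : ℕ → 𝕜} (hval : DenseRange val)
    (hval0 : val 0 = 0) (z : X) (j : ℕ) {α : 𝕜} (hα : α ≠ 0) {ε : ℝ} (hε : 0 < ε) :
    ∃ t : ℕ →₀ ℕ, S.Mem (A.weight j fun k => α * val (t k) - ι z k) ∧
      S.norm (A.weight j fun k => α * val (t k) - ι z k) < ε := by
  obtain ⟨K, hK⟩ := S.exists_tail_lt (A.weight_nonneg j (ι z)) (h.mem j z) (half_pos hε)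
  set η : ℝ := ε / (2 * (K + 1)) with hη
  have hη0 : 0 < η := by positivity
  -- At most `K` coordinates are approximated, with total error `K * η < ε / 2`; the others use `val
  -- 0 = 0` and the small tail of `z`.
  have hm : ∀ k, ∃ m, ‖α * val m - ι z k‖ * A j k ≤ η := fun k => by
    have hαn := norm_pos_iff.2 hα
    have hA := A.entry_pos j k
    obtain ⟨m, hm⟩ := hval.exists_dist_lt (ι z k / α) (ε := η / (‖α‖ * A j k)) (by positivity)
    refine ⟨m, ?_⟩
    have h1 : α * val m - ι z k = α * (val m - ι z k / α) := by field_simp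
    rw [dist_comm, dist_eq_norm, lt_div_iff₀ (by positivity)] at hm
    rw [h1, norm_mul]
    linarith
  choose m hm using hm
  refine ⟨Finsupp.onFinset (Finset.range K) (fun k => if k < K then m k else 0)
    (fun k hk => by simpa using (ite_ne_right_iff.1 hk).1), ?_⟩
  have hzero : ∀ k ∉ Finset.range K, (if k < K then η else 0) = 0 := fun k hk =>
    if_neg (by simpa using hk)
  have hη' : ∀ k, 0 ≤ (if k < K then η else 0) := fun k => by split_ifs; exacts [hη0.le, le_rfl]
  obtain ⟨h1, h2⟩ := S.mem_of_summable hη' (summable_of_ne_finset_zero hzero)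
  obtain ⟨h3, h4⟩ := S.add
    (fun k => by split_ifs; exacts [A.weight_nonneg j (ι z) k, le_rfl]) hη'
    (S.mem_tail (A.weight_nonneg j (ι z)) (h.mem j z) K) h1
  obtain ⟨h5, h6⟩ := S.mono (A.weight_nonneg j fun k =>
      α * val ((if k < K then m k else 0)) - ι z k) (fun k => by
    rcases lt_or_ge k K with hk | hk
    · rw [if_neg (not_le.2 hk), if_pos hk, zero_add]
      simpa [KotheMatrix.weight, hk] using hm k
    · simp [KotheMatrix.weight, hk, not_lt.2 hk, hval0]) h3
  refine ⟨h5, h6.trans_lt (h4.trans_lt ?_)⟩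
  rw [tsum_eq_sum hzero, Finset.sum_congr rfl fun k hk => if_pos (Finset.mem_range.1 hk)] at h2
  have h7 : (K : ℝ) * η < ε / 2 := by
    rw [hη, mul_div_assoc', div_lt_div_iff₀ (by positivity) (by norm_num)]
    nlinarith
  simp only [Finset.sum_const, Finset.card_range, nsmul_eq_mul] at h2
  linarith [hK K le_rfl]

theorem hasHypercyclicSubspace (h : IsKotheSpace S A ι P) (hw : ∀ n, w n ≠ 0)
    (hB : ∀ x k, ι (B x) k = w (k + 1) * ι x (k + 1)) (hs : ShiftInverseSmall A w) {J : ℕ}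
    (hA : A.CondB J) (hr : ShiftBoundedRuns A w J) : HasHypercyclicSubspace B := by
  obtain ⟨mm, C, hC, hgood⟩ := hr.forall_norm hA
  obtain ⟨val, hval, hval0⟩ : ∃ val : ℕ → 𝕜, DenseRange val ∧ val 0 = 0 := by
    refine ⟨fun m => Nat.casesOn m 0 (TopologicalSpace.denseSeq 𝕜), ?_, rfl⟩
    refine (TopologicalSpace.denseRange_denseSeq 𝕜).mono ?_
    rintro _ ⟨m, rfl⟩
    exact ⟨m + 1, rfl⟩
  -- The last factor makes each pair of a free coordinate and a target recur at arbitrarily late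
  -- stages.
  obtain ⟨φ, hφ⟩ := exists_surjective_nat (ℕ × (ℕ →₀ ℕ) × ℕ)
  let e : ℕ → ℕ := fun s => (φ s).1
  -- The target is suppressed unless its free coordinate lies in an earlier stage, the only case in
  -- which `δ s` controls that coordinate.
  let y : ℕ → ℕ → 𝕜 := fun s k => if e s < s then val ((φ s).2.1 k) else 0
  let L : ℕ → ℕ := fun s => (φ s).2.1.support.sup id + 1
  have hy : ∀ s k, L s ≤ k → y s k = 0 := fun s k hk => by
    have h1 : (φ s).2.1 k = 0 := by
      by_contra hne
      have := Finset.le_sup (f := id) (Finsupp.mem_support_iff.2 hne)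
      have h2 : k ≤ (φ s).2.1.support.sup id := this
      have h3 : (φ s).2.1.support.sup id + 1 ≤ k := hk
      omega
    simp [y, h1, hval0]
  have he : ∀ s, ¬ e s < s → y s = 0 := fun s hes => by
    funext k
    simp [y, hes]
  have hfreq : ∀ (i : ℕ) (t : ℕ →₀ ℕ) (s₀ : ℕ), ∃ s, s₀ ≤ s ∧ e s = i ∧ y s = fun k => val (t k) := by
    intro i t s₀
    choose g hg using fun l : ℕ => hφ (i, t, l)
    have hginj : Function.Injective g := fun l l' hl => by
      have := hg l
      rw [hl, hg l'] at this
      simpa using this.symm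
    obtain ⟨_, ⟨l, rfl⟩, hl⟩ := (Set.infinite_range_of_injective hginj).exists_gt (s₀ + i)
    refine ⟨g l, by omega, by simp [e, hg], ?_⟩
    funext k
    have : i < g l := by omega
    simp [y, e, hg, this]
  obtain ⟨Φ⟩ := exists_shiftStages (h.shiftBounded hB) hs hgood hy
  refine ⟨Φ.subspace ι e, h.isClosed_subspace Φ e, h.not_finiteDimensional_subspace Φ e hw,
    fun x hx hx0 => ?_⟩
  obtain ⟨i, hi⟩ := h.exists_free_coord_ne_zero Φ e hx hx0
  refine dense_iff_inter_open.2 fun U hU ⟨z, hz⟩ => ?_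
  obtain ⟨j, ε, hε, hball⟩ := h.exists_ball_subset hU hz
  obtain ⟨t, ht, ht'⟩ := h.exists_target_near hval hval0 z j hi (half_pos hε)
  have hw0 : ∀ c, 0 ≤ C j * A.weight (mm j) (ι x) c := fun c =>
    mul_nonneg (hC j).le (A.weight_nonneg _ _ c)
  have hb0 : ∀ c, 0 ≤ P 0 x * Φ.bound c := fun c =>
    mul_nonneg (apply_nonneg _ _) (Φ.bound_nonneg c)
  have hu := (S.add hw0 hb0 (S.smul (hC j).le (A.weight_nonneg _ _) (h.mem (mm j) x)).1
    (S.mem_of_summable hb0 (Φ.summable_bound.mul_left _)).1).1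
  have hu0 := fun c => add_nonneg (hw0 c) (hb0 c)
  obtain ⟨n₀, hn₀⟩ := S.exists_tail_lt hu0 hu (half_pos hε)
  obtain ⟨r, hr, her, hyr⟩ := hfreq i t (n₀ + j + 1)
  have hnr : r ≤ Φ.n r := Φ.b_strictMono.le_apply.trans (Φ.b_le_n r)
  refine ⟨B^[Φ.n r] x, hball _ ?_, Φ.n r, by omega, rfl⟩
  obtain ⟨h1, h2⟩ := S.shiftLeft (Φ.n r)
    (fun k => by split_ifs; exacts [hu0 k, le_rfl]) (S.mem_tail hu0 hu (Φ.n r))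
  simp only [Nat.le_add_right, if_true] at h1 h2
  obtain ⟨h3, h4⟩ := S.add (fun k => hu0 (Φ.n r + k)) (A.weight_nonneg j _) h1 ht
  have h5 := (S.mono (A.weight_nonneg j (ι (B^[Φ.n r] x - z))) (fun k => ?_) h3).2
  · rw [h.seminorm_apply]
    linarith [hn₀ (Φ.n r) (by omega)]
  · have h6 := h.norm_iterate_sub_target_le Φ e hw hC hy he hx (r := r) (j := j) (by omega) k
    rw [her, hyr] at h6
    refine le_trans ?_ (add_le_add_left h6 _)
    rw [KotheMatrix.weight, KotheMatrix.weight, ← add_mul, map_sub, Pi.sub_apply, coord_iterate hB]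
    refine mul_le_mul_of_nonneg_right ?_ (A.entry_pos j k).le
    refine le_trans (le_of_eq ?_) (norm_add_le _ _)
    congr 1
    ring

/-- Without `ShiftLiminfLeOne` there is growth, hence no subspace; with it growth fails, hence
bounded runs exist and the construction applies. -/
theorem hasHypercyclicSubspace_tfae (h : IsKotheSpace S A ι P) (hw : ∀ n, w n ≠ 0)
    (hB : ∀ x k, ι (B x) k = w (k + 1) * ι x (k + 1)) (hH : IsHypercyclicOperator B) {J : ℕ}
    (hA : A.CondB J) :
    (HasHypercyclicSubspace B ↔ ∃ m, shiftSup A w J m ≤ 1) ∧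
      (HasHypercyclicSubspace B ↔ ∃ m, shiftSup A w J m < ∞) := by
  have hc := h.shiftBounded hB
  have h12 : HasHypercyclicSubspace B → ∃ m, shiftSup A w J m ≤ 1 := fun h1 => by
    refine ShiftLiminfLeOne.exists_shiftSup_le ?_
    by_contra hL
    exact h.not_hasHypercyclicSubspace hB (shiftGrowth_of_not_liminfLeOne hc hL) h1
  have h23 : (∃ m, shiftSup A w J m ≤ 1) → ∃ m, shiftSup A w J m < ∞ := fun ⟨m, hm⟩ =>
    ⟨m, hm.trans_lt ENNReal.one_lt_top⟩
  have h31 : (∃ m, shiftSup A w J m < ∞) → HasHypercyclicSubspace B := fun h3 => by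
    refine h.hasHypercyclicSubspace hw hB (h.inverseSmall hw hB hH) hA ?_
    by_contra hr
    exact (liminfLeOne_of_shiftSup_lt_top hc hw h3).not_growth hA
      (shiftGrowth_of_not_boundedRuns hc hr)
  exact ⟨⟨h12, fun h2 => h31 (h23 h2)⟩, ⟨fun h1 => h23 (h12 h1), h31⟩⟩

end IsKotheSpace

/-! ### The norms of c_0 and ℓ^p, and the conclusion -/

/-- The supremum norm on the null sequences. -/
def c0SolidNorm : SolidNorm where
  Mem u := Tendsto u atTop (𝓝 0)
  norm u := ⨆ k, u k
  mono h0 huv hv := ⟨squeeze_zero h0 huv hv, ciSup_mono hv.bddAbove_range huv⟩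
  tsum {u} h0 hu hs := by
    have hle : ∀ i k, u i k ≤ ⨆ k, u i k := fun i k => le_ciSup (hu i).bddAbove_range k
    have hsk : ∀ k, Summable fun i => u i k := fun k =>
      Summable.of_nonneg_of_le (fun i => h0 i k) (fun i => hle i k) hs
    refine ⟨?_, ciSup_le fun k => (hsk k).tsum_le_tsum (fun i => hle i k) hs⟩
    -- The limit in `k` passes through the sum over `i`, dominated by the summable norms.
    have := tendsto_tsum_of_dominated_convergence (f := fun k i => u i k) (𝓕 := atTop) hs hu
      (Eventually.of_forall fun k i => by rw [Real.norm_of_nonneg (h0 i k)]; exact hle i k)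
    simpa using this
  add {u v} _ _ hu hv := by
    refine ⟨by simpa using hu.add hv, ciSup_le fun k => ?_⟩
    exact add_le_add (le_ciSup hu.bddAbove_range k) (le_ciSup hv.bddAbove_range k)
  smul {u c} hc _ hu := ⟨by simpa using hu.const_mul c, (Real.mul_iSup_of_nonneg hc u).symm⟩
  single k := by
    refine ⟨tendsto_const_nhds.congr' ?_, ciSup_le fun i => ?_⟩
    · filter_upwards [eventually_gt_atTop k] with i hi
      simp [hi.ne']
    · by_cases h : i = k
      · subst h; simp
      · simp [h]
  le_norm _ hu k := le_ciSup hu.bddAbove_range k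
  shiftRight {u} n h0 hu := by
    refine ⟨(hu.comp (tendsto_sub_atTop_nat n)).congr' ?_, ciSup_le fun c => ?_⟩
    · filter_upwards [eventually_ge_atTop n] with c hc
      simp [hc]
    · dsimp only
      split_ifs
      · exact le_ciSup hu.bddAbove_range _
      · exact (h0 0).trans (le_ciSup hu.bddAbove_range 0)
  shiftLeft {u} n _ hu := by
    refine ⟨hu.comp (tendsto_atTop_mono (fun k => Nat.le_add_left k n) tendsto_id),
      ciSup_le fun k => le_ciSup hu.bddAbove_range _⟩
  tail {u} h0 hu := by
    refine Metric.tendsto_atTop.2 fun ε hε => ?_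
    obtain ⟨N, hN⟩ := eventually_atTop.1 (hu.eventually (gt_mem_nhds (half_pos hε)))
    refine ⟨N, fun n hn => ?_⟩
    rw [Real.dist_0_eq_abs, abs_of_nonneg (Real.iSup_nonneg fun k => by
      split_ifs; exacts [h0 k, le_rfl])]
    refine lt_of_le_of_lt (ciSup_le fun k => ?_) (half_lt_self hε)
    split_ifs with hk
    · exact (hN k (hn.trans hk)).le
    · exact (half_pos hε).le

lemma tsum_tail_eq {g : ℕ → ℝ} {n : ℕ} (hg : ∀ k, k < n → g k = 0)
    (hs : Summable fun k => g (k + n)) : Summable g ∧ ∑' k, g k = ∑' k, g (k + n) := by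
  have h1 := (summable_nat_add_iff n).1 hs
  refine ⟨h1, ?_⟩
  rw [← h1.sum_add_tsum_nat_add n, Finset.sum_eq_zero fun k hk => hg k (Finset.mem_range.1 hk),
    zero_add]

/-- The norm of `ℓ^p`. -/
def lpSolidNorm (p : ℝ) (hp : 1 ≤ p) : SolidNorm :=
  have hp0 : 0 < p := by linarith
  have hp' : 0 < 1 / p := by positivity
  have hmono : ∀ {u v : ℕ → ℝ}, (∀ k, 0 ≤ u k) → (∀ k, u k ≤ v k) → Summable (fun k => v k ^ p) →
      Summable (fun k => u k ^ p) ∧ (∑' k, u k ^ p) ^ (1 / p) ≤ (∑' k, v k ^ p) ^ (1 / p) :=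
    fun {u v} h0 huv hv => by
      have h1 : ∀ k, u k ^ p ≤ v k ^ p := fun k => Real.rpow_le_rpow (h0 k) (huv k) hp0.le
      have h2 : ∀ k, 0 ≤ u k ^ p := fun k => Real.rpow_nonneg (h0 k) p
      have h3 := Summable.of_nonneg_of_le h2 h1 hv
      exact ⟨h3, Real.rpow_le_rpow (tsum_nonneg h2) (h3.tsum_le_tsum h1 hv) hp'.le⟩
  have hle : ∀ {u : ℕ → ℝ}, (∀ k, 0 ≤ u k) → Summable (fun k => u k ^ p) →
      ∀ k, u k ≤ (∑' k, u k ^ p) ^ (1 / p) := fun {u} h0 hu k => by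
    have h2 : ∀ k, 0 ≤ u k ^ p := fun k => Real.rpow_nonneg (h0 k) p
    rw [one_div, Real.le_rpow_inv_iff_of_pos (h0 k) (tsum_nonneg h2) hp0]
    exact hu.le_tsum k fun i _ => h2 i
  { Mem := fun u => Summable fun k => u k ^ p
    norm := fun u => (∑' k, u k ^ p) ^ (1 / p)
    mono := hmono
    tsum := fun {u} h0 hu hs => by
      have hsk : ∀ k, Summable fun i => u i k := fun k =>
        Summable.of_nonneg_of_le (fun i => h0 i k) (fun i => hle (h0 i) (hu i) k) hs
      have hnn : ∀ i, 0 ≤ (∑' k, u i k ^ p) ^ (1 / p) := fun i =>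
        (h0 i 0).trans (hle (h0 i) (hu i) 0)
      set T := ∑' i, (∑' k, u i k ^ p) ^ (1 / p)
      have hT : 0 ≤ T := tsum_nonneg hnn
      have hfin : ∀ n, Summable (fun k => (∑ i ∈ Finset.range n, u i k) ^ p) ∧
          (∑' k, (∑ i ∈ Finset.range n, u i k) ^ p) ^ (1 / p) ≤
            ∑ i ∈ Finset.range n, (∑' k, u i k ^ p) ^ (1 / p) := by
        intro n
        induction n with
        | zero => simp [Real.zero_rpow hp0.ne', Real.zero_rpow (inv_pos.2 hp0).ne', summable_zero]
        | succ n ih =>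
          have h1 := fun k => Finset.sum_nonneg fun i (_ : i ∈ Finset.range n) => h0 i k
          have h2 := Real.summable_Lp_add_of_nonneg hp h1 (h0 n) ih.1 (hu n)
          have h3 := (Real.Lp_add_le_tsum_of_nonneg hp h1 (h0 n) ih.1 (hu n)).2
          simp only [Finset.sum_range_succ]
          exact ⟨h2, h3.trans (add_le_add_left ih.2 _)⟩
      -- Countable Minkowski inequality: on a finite set of coordinates the finite inequality `hfin`
      -- passes to the limit.
      have hsum : ∀ K : Finset ℕ, ∑ k ∈ K, (∑' i, u i k) ^ p ≤ T ^ p := by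
        intro K
        have hlim : Tendsto (fun n => ∑ k ∈ K, (∑ i ∈ Finset.range n, u i k) ^ p) atTop
            (𝓝 (∑ k ∈ K, (∑' i, u i k) ^ p)) :=
          tendsto_finsetSum _ fun k _ =>
            (hsk k).hasSum.tendsto_sum_nat.rpow_const (Or.inr hp0.le)
        refine le_of_tendsto' hlim fun n => ?_
        have h1 : ∀ k, 0 ≤ (∑ i ∈ Finset.range n, u i k) ^ p := fun k =>
          Real.rpow_nonneg (Finset.sum_nonneg fun i _ => h0 i k) p
        have h2 : _ ≤ T := (hfin n).2.trans (hs.sum_le_tsum _ fun i _ => hnn i)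
        rw [one_div, Real.rpow_inv_le_iff_of_pos (tsum_nonneg h1) hT hp0] at h2
        exact ((hfin n).1.sum_le_tsum K fun k _ => h1 k).trans h2
      have hnn' : ∀ k, 0 ≤ (∑' i, u i k) ^ p := fun k =>
        Real.rpow_nonneg (tsum_nonneg fun i => h0 i k) p
      have h3 := summable_of_sum_le hnn' hsum
      refine ⟨h3, ?_⟩
      rw [one_div, Real.rpow_inv_le_iff_of_pos (tsum_nonneg hnn') hT hp0]
      exact h3.tsum_le_of_sum_le hsum
    add := fun hu0 hv0 hu hv =>
      ⟨Real.summable_Lp_add_of_nonneg hp hu0 hv0 hu hv,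
        (Real.Lp_add_le_tsum_of_nonneg hp hu0 hv0 hu hv).2⟩
    smul := fun {u c} hc h0 hu => by
      have h1 : ∀ k, (c * u k) ^ p = c ^ p * u k ^ p := fun k => Real.mul_rpow hc (h0 k)
      simp only [h1]
      refine ⟨hu.mul_left _, ?_⟩
      rw [tsum_mul_left, Real.mul_rpow (Real.rpow_nonneg hc p)
        (tsum_nonneg fun k => Real.rpow_nonneg (h0 k) p), ← Real.rpow_mul hc,
        mul_one_div_cancel hp0.ne', Real.rpow_one]
    single := fun k => by
      have h1 : ∀ i ∉ ({k} : Finset ℕ), (Pi.single k 1 : ℕ → ℝ) i ^ p = 0 := fun i hi => by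
        have : i ≠ k := by simpa using hi
        simp [this, Real.zero_rpow hp0.ne']
      refine ⟨summable_of_ne_finset_zero h1, ?_⟩
      rw [tsum_eq_sum h1]
      simp
    le_norm := hle
    shiftRight := fun {u} n h0 hu => by
      have h1 : ∀ k, (if n ≤ k + n then u (k + n - n) else 0) ^ p = u k ^ p := fun k => by simp
      obtain ⟨h2, h3⟩ := tsum_tail_eq (g := fun c => (if n ≤ c then u (c - n) else 0) ^ p) (n := n)
        (fun k hk => by simp [not_le.2 hk, Real.zero_rpow hp0.ne']) (hu.congr fun k => (h1 k).symm)
      refine ⟨h2, ?_⟩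
      rw [h3, tsum_congr h1]
    shiftLeft := fun {u} n h0 hu => by
      have h2 : ∀ k, 0 ≤ u k ^ p := fun k => Real.rpow_nonneg (h0 k) p
      have h1 : Function.Injective fun k => n + k := add_right_injective n
      have h3 : Summable fun k => u (n + k) ^ p := hu.comp_injective h1
      refine ⟨h3, Real.rpow_le_rpow (tsum_nonneg fun k => h2 _) ?_ hp'.le⟩
      exact h3.tsum_le_tsum_of_inj _ h1 (fun c _ => h2 c) (fun k => le_rfl) hu
    tail := fun {u} h0 hu => by
      have h1 : ∀ n, ∑' k, (if n ≤ k then u k else 0) ^ p = ∑' k, u (k + n) ^ p := fun n => by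
        have h2 : ∀ k, (if n ≤ k + n then u (k + n) else 0) ^ p = u (k + n) ^ p := fun k => by simp
        rw [(tsum_tail_eq (g := fun c => (if n ≤ c then u c else 0) ^ p) (n := n)
          (fun k hk => by simp [not_le.2 hk, Real.zero_rpow hp0.ne'])
          (((summable_nat_add_iff n).2 hu).congr fun k => (h2 k).symm)).2, tsum_congr h2]
      have h3 := (tendsto_sum_nat_add fun k => u k ^ p).rpow_const (p := 1 / p) (Or.inr hp'.le)
      rw [Real.zero_rpow hp'.ne'] at h3
      simpa only [h1] using h3 }

/-- The coordinates of the elements of `λ^p(A)`. -/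
def kotheLpCoords (𝕜 : Type*) [RCLike 𝕜] (p : ℝ) [Fact (1 ≤ p)] (A : KotheMatrix) :
    KotheLp 𝕜 p A →ₗ[𝕜] (ℕ → 𝕜) :=
  (kotheLpSubmodule 𝕜 p A).subtype

/-- The coordinates of the elements of `c_0(A)`. -/
def kotheC0Coords (𝕜 : Type*) [RCLike 𝕜] (A : KotheMatrix) : KotheC0 𝕜 A →ₗ[𝕜] (ℕ → 𝕜) :=
  (kotheC0Submodule 𝕜 A).subtype

lemma isKotheSpace_kotheLp (𝕜 : Type*) [RCLike 𝕜] (p : ℝ) [hp : Fact (1 ≤ p)] (A : KotheMatrix) :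
    IsKotheSpace (lpSolidNorm p hp.out) A (kotheLpCoords 𝕜 p A) (kotheLpNorm 𝕜 p A) where
  injective := Subtype.val_injective
  exists_iff x := ⟨fun ⟨v, hv⟩ => hv ▸ v.2, fun hx => ⟨⟨x, hx⟩, rfl⟩⟩
  seminorm_apply _ _ := rfl
  withSeminorms := ⟨rfl⟩

lemma isKotheSpace_kotheC0 (𝕜 : Type*) [RCLike 𝕜] (A : KotheMatrix) :
    IsKotheSpace c0SolidNorm A (kotheC0Coords 𝕜 A) (kotheC0Norm 𝕜 A) where
  injective := Subtype.val_injective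
  exists_iff x := ⟨fun ⟨v, hv⟩ => hv ▸ v.2, fun hx => ⟨⟨x, hx⟩, rfl⟩⟩
  seminorm_apply _ _ := rfl
  withSeminorms := ⟨rfl⟩

end

theorem theorem4p5 {𝕜 : Type*} [RCLike 𝕜] (A : KotheMatrix) (J : ℕ) (hA : A.CondB J)
    (w : ℕ → 𝕜) (hw : ∀ n, w n ≠ 0) :
    (∀ (p : ℝ) [Fact (1 ≤ p)] (B : KotheLp 𝕜 p A →L[𝕜] KotheLp 𝕜 p A),
      (∀ x k, (B x) k = w (k + 1) * x (k + 1)) → IsHypercyclicOperator B →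
        ((HasHypercyclicSubspace B ↔ ∃ m, shiftSup A w J m ≤ 1) ∧
          (HasHypercyclicSubspace B ↔ ∃ m, shiftSup A w J m < ∞))) ∧
    (∀ B : KotheC0 𝕜 A →L[𝕜] KotheC0 𝕜 A,
      (∀ x k, (B x) k = w (k + 1) * x (k + 1)) → IsHypercyclicOperator B →
        ((HasHypercyclicSubspace B ↔ ∃ m, shiftSup A w J m ≤ 1) ∧
          (HasHypercyclicSubspace B ↔ ∃ m, shiftSup A w J m < ∞))) :=
  ⟨fun p _ _ hB hH => (isKotheSpace_kotheLp 𝕜 p A).hasHypercyclicSubspace_tfae hw hB hH hA,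
    fun _ hB hH => (isKotheSpace_kotheC0 𝕜 A).hasHypercyclicSubspace_tfae hw hB hH hA⟩
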